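/- Let $n\ge 1$ and $s\in(0,1)$, and let all functions on $\mathbb R^n$ be $\mathbb K$-valued with $\mathbb K=\mathbb R$ or $\mathbb K=\mathbb C$. Let $\mathcal S$ be the Schwartz class on $\mathbb R^n$, and write $\hat\phi(\xi)=\int_{\mathbb R^n}\phi(x)e^{-2\pi i x\cdot\xi}\,dx$. Let $\mathcal S_s$ be the space of $f\in C^\infty(\mathbb R^n)$ with $\sup_{x}(1+|x|^{n+s})|D^\alpha f(x)|<\infty$ for every multi-index $\alpha$, topologized by these seminorms, and let $\mathcal S_s'$ be its topological dual. For $\phi\in\mathcal S$ define $$(\nabla^s_+\phi)^\wedge(\xi)=(2\pi|\xi|)^s\hat\phi(\xi),\qquad (\nabla^s_j\phi)^\wedge(\xi)=(-2\pi i\xi_j)(2\pi|\xi|)^{s-1}\hat\phi(\xi)\quad(1\le j\le n);$$ these functions belong to $\mathcal S_s$. For $u\in\mathcal S_s'$ define distributions $\nabla^s_+u$ and $\nabla^s_-u=(\nabla^s_1u,\dots,\nabla^s_nu)$ by $$\langle\nabla^s_+u,\phi\rangle=\langle u,\nabla^s_+\phi\rangle,\qquad \langle\nabla^s_ju,\phi\rangle=-\langle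 u,\nabla^s_j\phi\rangle\qquad(\phi\in\mathcal S),$$ and let $$H^{s,1}_\pm=\{u\in\mathcal S_s':\ [u]_{H^{s,1}_\pm}=\|\nabla^s_\pm u\|_{L^1}<\infty\},$$ where the norm is finite exactly when the distribution is given by an integrable function. For $\phi\in\mathcal S$ let $I_s\phi$ be the Riesz potential, $I_s\phi(x)=\int_{\mathbb R^n}(2\pi|\xi|)^{-s}\hat\phi(\xi)e^{2\pi i x\cdot\xi}\,d\xi$, a bounded continuous function regarded as the element $f\mapsto\int_{\mathbb R^n} I_s\phi\, f\,dx$ of $\mathcal S_s'$. Then $I_s(\mathcal S)=\{I_s\phi:\phi\in\mathcal S\}$ is a linear subspace of $H^{s,1}_+$ which is dense with respect to $[\cdot]_{H^{s,1}_+}$: for every $u\in H^{s,1}_+$ and every $\varepsilon>0$ there is $v\in I_s(\mathcal S)$ with $[u-v]_{H^{s,1}_+}<\varepsilon$. However, $I_s(\mathcal S)\not\subset H^{s,1}_-$. -/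

import Mathlib

namespace FracHardySobolev

open MeasureTheory SchwartzMap Filter Topology FourierTransform
open scoped ContDiff ENNReal

section decay

set_option linter.unusedSectionVars false

variable {V : Type*} [NormedAddCommGroup V] [InnerProductSpace ℝ V] [FiniteDimensional ℝ V]

theorem exists_smooth_symbol {s : ℝ} (hs : 0 < s) {m : V → ℂ}
    (hm : ∀ ξ, ξ ≠ 0 → ContDiffAt ℝ ∞ m ξ)
    (hh : ∀ t : ℝ, 0 < t → ∀ ξ, m (t • ξ) = (t ^ s) • m ξ) :
    ∃ N : V → ℂ, ContDiff ℝ ∞ N ∧ (∀ ξ, 1 / 2 ≤ ‖ξ‖ → N ξ = m ξ) ∧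
      ∀ k : ℕ, ∃ C, 0 ≤ C ∧ ∀ ξ, ‖iteratedFDeriv ℝ k N ξ‖ ≤ C * (1 + ‖ξ‖) ^ (s - k) := by
  let χ : ContDiffBump (0 : V) := ⟨1 / 4, 1 / 2, by norm_num, by norm_num⟩
  let N : V → ℂ := fun ξ => (1 - χ ξ) • m ξ
  have hN : ContDiff ℝ ∞ N := by
    rw [contDiff_iff_contDiffAt]
    intro ξ
    by_cases h : ξ = 0
    · subst h
      refine (contDiffAt_const (c := (0 : ℂ))).congr_of_eventuallyEq ?_
      filter_upwards [χ.eventuallyEq_one] with y hy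
      simp [N, hy]
    · exact (contDiffAt_const.sub χ.contDiff.contDiffAt).smul (hm ξ h)
  have hNm : ∀ ξ, 1 / 2 ≤ ‖ξ‖ → N ξ = m ξ := by
    intro ξ hξ
    have : χ ξ = 0 := χ.zero_of_le_dist (by simpa [χ] using hξ)
    simp [N, this]
  refine ⟨N, hN, hNm, fun k => ?_⟩
  have hk : ContDiff ℝ k N := hN.of_le (by exact_mod_cast le_top)
  have hcont : Continuous (iteratedFDeriv ℝ k N) := hk.continuous_iteratedFDeriv le_rfl
  obtain ⟨C, hC⟩ := (isCompact_closedBall (0 : V) 1).exists_bound_of_continuousOn hcont.continuousOn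
  have hC0 : 0 ≤ C := (norm_nonneg _).trans (hC 0 (by simp))
  refine ⟨2 ^ k * C, by positivity, fun ξ => ?_⟩
  have h1 : (0 : ℝ) < 1 + ‖ξ‖ := by positivity
  rw [Real.rpow_sub h1, Real.rpow_natCast]
  rcases le_total ‖ξ‖ 1 with h | h
  · have h2 := hC ξ (by simpa using h)
    have h3 : 1 ≤ (1 + ‖ξ‖) ^ s := Real.one_le_rpow (by linarith [norm_nonneg ξ]) hs.le
    have h4 : (1 + ‖ξ‖) ^ k ≤ 2 ^ k := by gcongr; linarith
    calc _ ≤ C := h2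
      _ ≤ C * ((1 + ‖ξ‖) ^ s * (2 ^ k / (1 + ‖ξ‖) ^ k)) := by
        apply le_mul_of_one_le_right hC0
        apply one_le_mul_of_one_le_of_one_le h3
        rwa [one_le_div (by positivity)]
      _ = _ := by ring
  · set r := ‖ξ‖ with hr
    have hr0 : 0 < r := by linarith
    set z := r⁻¹ • ξ with hz
    have hzn : ‖z‖ = 1 := by
      rw [hz, norm_smul, norm_inv, Real.norm_of_nonneg hr0.le]
      field_simp; exact hr.symm
    have hrz : r • z = ξ := by rw [hz, smul_smul, mul_inv_cancel₀ hr0.ne', one_smul]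
    have e : (fun y => N (r • y)) =ᶠ[𝓝 z] fun y => (r ^ s) • N y := by
      have : ∀ᶠ y in 𝓝 z, 1 / 2 < ‖y‖ :=
        continuous_norm.continuousAt.eventually_const_lt (by simp only [hzn]; norm_num)
      filter_upwards [this] with y hy
      rw [hNm y hy.le, hNm (r • y), hh r hr0]
      rw [norm_smul, Real.norm_of_nonneg hr0.le]
      nlinarith
    have e2 := e.iteratedFDeriv ℝ k |>.self_of_nhds
    rw [congrFun (iteratedFDeriv_comp_const_smul r hk) z,
      iteratedFDeriv_const_smul_apply' hk.contDiffAt, hrz] at e2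
    have e3 := congrArg norm e2
    rw [norm_smul, norm_smul, norm_pow, Real.norm_of_nonneg hr0.le,
      Real.norm_of_nonneg (by positivity)] at e3
    have e4 := hC z (by simp [hzn])
    have e5 : ‖iteratedFDeriv ℝ k N ξ‖ = r ^ s * ‖iteratedFDeriv ℝ k N z‖ / r ^ k := by
      rw [eq_div_iff (by positivity), ← e3]; ring
    rw [e5]
    have h6 : r ^ s ≤ (1 + r) ^ s := by gcongr; linarith
    have h7 : (1 + r) ^ k ≤ 2 ^ k * r ^ k := by rw [← mul_pow]; gcongr; linarith
    rw [div_le_iff₀ (by positivity)]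
    calc _ ≤ (1 + r) ^ s * C := by gcongr
      _ ≤ (1 + r) ^ s * C * ((2 ^ k * r ^ k) / (1 + r) ^ k) := by
        apply le_mul_of_one_le_right (by positivity)
        rwa [one_le_div (by positivity)]
      _ = _ := by ring

variable {F : Type*} [NormedAddCommGroup F] [NormedSpace ℂ F]

theorem norm_iteratedFDeriv_dilate_le (ψ : 𝓢(V, F)) (j : ℕ) :
    ∃ C, 0 ≤ C ∧ ∀ t : ℝ, 0 < t → t ≤ 1 → ∀ η,
      ‖iteratedFDeriv ℝ j (fun y => ψ (t • y)) η‖ ≤ C / (1 + ‖η‖) ^ j := by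
  refine ⟨2 ^ j * (Finset.Iic (j, j)).sup (fun m => SchwartzMap.seminorm ℝ m.1 m.2) ψ,
    by positivity, fun t ht ht1 η => ?_⟩
  rw [congrFun (iteratedFDeriv_comp_const_smul t (ψ.smooth j)) η, norm_smul, norm_pow,
    Real.norm_of_nonneg ht.le, le_div_iff₀ (by positivity)]
  have h := one_add_le_sup_seminorm_apply (𝕜 := ℝ) (m := (j, j)) le_rfl le_rfl ψ (t • η)
  refine le_trans ?_ h
  have : t ^ j * (1 + ‖η‖) ^ j ≤ (1 + ‖t • η‖) ^ j := by
    rw [← mul_pow, norm_smul, Real.norm_of_nonneg ht.le]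
    gcongr; linarith
  calc _ = (t ^ j * (1 + ‖η‖) ^ j) * ‖iteratedFDeriv ℝ j ψ (t • η)‖ := by ring
    _ ≤ _ := by gcongr

theorem norm_iteratedFDeriv_symbol_dilate_le {s : ℝ} {N : V → ℂ} (hN : ContDiff ℝ ∞ N)
    (hb : ∀ k : ℕ, ∃ C, 0 ≤ C ∧ ∀ ξ, ‖iteratedFDeriv ℝ k N ξ‖ ≤ C * (1 + ‖ξ‖) ^ (s - k))
    (ψ : 𝓢(V, F)) (p : ℕ) :
    ∃ C, 0 ≤ C ∧ ∀ t : ℝ, 0 < t → t ≤ 1 → ∀ η,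
      ‖iteratedFDeriv ℝ p (fun y => N y • ψ (t • y)) η‖ ≤ C * (1 + ‖η‖) ^ (s - p) := by
  choose A hA0 hA using hb
  choose B hB0 hB using norm_iteratedFDeriv_dilate_le ψ
  refine ⟨∑ i ∈ Finset.range (p + 1), (p.choose i : ℝ) * A i * B (p - i),
    Finset.sum_nonneg fun i _ => by have := hA0 i; have := hB0 (p - i); positivity,
    fun t ht ht1 η => ?_⟩
  have hψ : ContDiff ℝ ∞ (fun y => ψ (t • y)) := (ψ.smooth ⊤).comp (contDiff_const_smul t)
  have h1 : (0 : ℝ) < 1 + ‖η‖ := by positivity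
  have hNψ : ContDiff ℝ p N := hN.of_le (by exact_mod_cast le_top)
  have hψp : ContDiff ℝ p (fun y => ψ (t • y)) := hψ.of_le (by exact_mod_cast le_top)
  refine ((ContinuousLinearMap.lsmul ℝ ℂ : ℂ →L[ℝ] F →L[ℝ] F).norm_iteratedFDeriv_le_of_bilinear_of_le_one
    hNψ hψp η le_rfl ContinuousLinearMap.opNorm_lsmul_le).trans ?_
  rw [Finset.sum_mul]
  refine Finset.sum_le_sum fun i hi => ?_
  have hip : i ≤ p := Nat.lt_succ_iff.mp (Finset.mem_range.mp hi)
  have e : (1 + ‖η‖) ^ (s - p) = (1 + ‖η‖) ^ (s - i) / (1 + ‖η‖) ^ (p - i) := by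
    rw [← Real.rpow_natCast _ (p - i), ← Real.rpow_sub h1, Nat.cast_sub hip]; congr 1; ring
  calc _ ≤ (p.choose i : ℝ) * (A i * (1 + ‖η‖) ^ (s - i)) * (B (p - i) / (1 + ‖η‖) ^ (p - i)) := by
        have := hA0 i
        gcongr
        · exact hA i η
        · exact hB (p - i) t ht ht1 η
    _ = _ := by rw [e]; ring


variable [MeasurableSpace V] [BorelSpace V]

theorem exists_norm_symbol_le {s : ℝ} (hs : 0 < s) {m : V → ℂ}
    (hm : ∀ ξ, ξ ≠ 0 → ContDiffAt ℝ ∞ m ξ)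
    (hh : ∀ t : ℝ, 0 < t → ∀ ξ, m (t • ξ) = (t ^ s) • m ξ) :
    Continuous m ∧ ∃ M, 0 ≤ M ∧ ∀ ξ, ‖m ξ‖ ≤ M * ‖ξ‖ ^ s := by
  obtain ⟨N, -, hNm, hb⟩ := exists_smooth_symbol hs hm hh
  obtain ⟨C, hC0, hC⟩ := hb 0
  have h0 : m 0 = 0 := by
    have h := hh 2 (by norm_num) 0
    rw [smul_zero] at h
    have h2 : (1 : ℝ) < 2 ^ s := Real.one_lt_rpow (by norm_num) hs
    by_contra hne
    have h3 := congrArg norm h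
    rw [norm_smul, Real.norm_of_nonneg (by positivity)] at h3
    have := norm_pos_iff.mpr hne
    nlinarith
  have key : ∀ ξ, ‖m ξ‖ ≤ C * 2 ^ s * ‖ξ‖ ^ s := by
    intro ξ
    by_cases hξ : ξ = 0
    · subst hξ; rw [h0, norm_zero]; positivity
    have hr : 0 < ‖ξ‖ := norm_pos_iff.mpr hξ
    have hzn : ‖‖ξ‖⁻¹ • ξ‖ = 1 := by
      rw [norm_smul, norm_inv, norm_norm]; field_simp
    have h1 := hh ‖ξ‖ hr (‖ξ‖⁻¹ • ξ)
    rw [smul_smul, mul_inv_cancel₀ hr.ne', one_smul] at h1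
    rw [h1, norm_smul, Real.norm_of_nonneg (by positivity), ← hNm _ (by rw [hzn]; norm_num)]
    have h2 := hC (‖ξ‖⁻¹ • ξ)
    rw [hzn, norm_iteratedFDeriv_zero] at h2
    norm_num at h2
    calc _ ≤ ‖ξ‖ ^ s * (C * 2 ^ s) := by gcongr
      _ = _ := by ring
  refine ⟨?_, _, by positivity, key⟩
  rw [continuous_iff_continuousAt]
  intro ξ
  by_cases hξ : ξ = 0
  · subst hξ
    rw [ContinuousAt, h0]
    refine squeeze_zero_norm key ?_
    have : Continuous fun ξ : V => C * 2 ^ s * ‖ξ‖ ^ s :=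
      continuous_const.mul (continuous_norm.rpow_const fun _ => Or.inr hs.le)
    have h := this.tendsto 0
    simpa [Real.zero_rpow hs.ne'] using h
  · exact (hm ξ hξ).continuousAt

theorem integrable_pow_mul_symbol_smul {s : ℝ} (hs : 0 < s) {m : V → ℂ}
    (hm : ∀ ξ, ξ ≠ 0 → ContDiffAt ℝ ∞ m ξ)
    (hh : ∀ t : ℝ, 0 < t → ∀ ξ, m (t • ξ) = (t ^ s) • m ξ) (ψ : 𝓢(V, F)) (k : ℕ) :
    Integrable (fun ξ => ‖ξ‖ ^ k * ‖m ξ • ψ ξ‖) := by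
  obtain ⟨hcont, M, hM0, hM⟩ := exists_norm_symbol_le hs hm hh
  obtain ⟨q, hq⟩ := exists_nat_gt s
  refine ((((ψ.integrable_pow_mul volume k).add (ψ.integrable_pow_mul volume (k + q))).const_mul
    M)).mono' ?_ ?_
  · exact ((continuous_norm.pow k).mul (hcont.smul ψ.continuous).norm).aestronglyMeasurable
  · refine Eventually.of_forall fun ξ => ?_
    rw [Real.norm_of_nonneg (by positivity), norm_smul]
    have h1 : ‖ξ‖ ^ s ≤ 1 + ‖ξ‖ ^ q := by
      rcases le_total ‖ξ‖ 1 with h | h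
      · have := Real.rpow_le_one (norm_nonneg ξ) h hs.le
        have : 0 ≤ ‖ξ‖ ^ q := by positivity
        linarith
      · have := Real.rpow_le_rpow_of_exponent_le h hq.le
        rw [Real.rpow_natCast] at this
        linarith
    calc _ ≤ ‖ξ‖ ^ k * (M * (1 + ‖ξ‖ ^ q) * ‖ψ ξ‖) := by
          gcongr; exact (hM ξ).trans (by gcongr)
      _ = M * (‖ξ‖ ^ k * ‖ψ ξ‖ + ‖ξ‖ ^ (k + q) * ‖ψ ξ‖) := by rw [pow_add]; ring

theorem integrable_symbol_smul {s : ℝ} (hs : 0 < s) {m : V → ℂ}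
    (hm : ∀ ξ, ξ ≠ 0 → ContDiffAt ℝ ∞ m ξ)
    (hh : ∀ t : ℝ, 0 < t → ∀ ξ, m (t • ξ) = (t ^ s) • m ξ) (ψ : 𝓢(V, F)) :
    Integrable (fun ξ => m ξ • ψ ξ) := by
  obtain ⟨hcont, -⟩ := exists_norm_symbol_le hs hm hh
  have := integrable_pow_mul_symbol_smul hs hm hh ψ 0
  simp only [pow_zero, one_mul] at this
  exact (integrable_norm_iff (hcont.smul ψ.continuous).aestronglyMeasurable).mp this

theorem norm_fourier_le_integral (f : V → F) (w : V) : ‖𝓕 f w‖ ≤ ∫ v, ‖f v‖ :=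
  VectorFourier.norm_fourierIntegral_le_integral_norm _ _ _ _ _

theorem norm_fourier_schwartz_le (g : 𝓢(V, F)) (P : ℕ) (θ : V) (hθ : ‖θ‖ = 1) :
    ‖𝓕 (fun η => g η) θ‖ ≤ ∫ v, ‖iteratedFDeriv ℝ P g v‖ := by
  have h := congrFun (Real.fourier_iteratedFDeriv (N := (P : ℕ∞)) (f := fun η => g η)
    ((g.smooth ⊤).of_le (by exact_mod_cast le_top))
    (fun n _ => by
      have := g.integrable_pow_mul_iteratedFDeriv volume 0 n
      simp only [pow_zero, one_mul] at this
      exact (integrable_norm_iff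
        ((g.smooth ⊤).continuous_iteratedFDeriv (mod_cast le_top)).aestronglyMeasurable).mp this)
    (n := P) le_rfl) θ
  have h2 := norm_fourier_le_integral (iteratedFDeriv ℝ P (fun η => g η)) θ
  rw [h] at h2
  refine le_trans ?_ h2
  refine le_trans ?_ (ContinuousMultilinearMap.unit_le_opNorm _ (m := fun _ => θ) ?_)
  · rw [VectorFourier.fourierPowSMulRight_apply]
    have h1 : (innerSL ℝ θ) θ = 1 := by
      rw [innerSL_apply_apply, real_inner_self_eq_norm_sq, hθ]; norm_num
    simp [norm_smul, h1]
    apply le_mul_of_one_le_left (norm_nonneg _)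
    apply one_le_pow₀
    rw [abs_of_nonneg Real.pi_nonneg]
    linarith [Real.pi_gt_three]
  · exact (pi_norm_le_iff_of_nonneg zero_le_one).mpr fun _ => hθ.le

theorem norm_fourier_symbol_dilate_le {s : ℝ} (hs : 0 < s) {m : V → ℂ}
    (hm : ∀ ξ, ξ ≠ 0 → ContDiffAt ℝ ∞ m ξ)
    (hh : ∀ t : ℝ, 0 < t → ∀ ξ, m (t • ξ) = (t ^ s) • m ξ) (ψ : 𝓢(V, F)) :
    ∃ C, 0 ≤ C ∧ ∀ t : ℝ, 0 < t → t ≤ 1 → ∀ θ, ‖θ‖ = 1 →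
      ‖𝓕 (fun η => m η • ψ (t • η)) θ‖ ≤ C := by
  obtain ⟨N, hN, hNm, hb⟩ := exists_smooth_symbol hs hm hh
  obtain ⟨hcont, M, hM0, hM⟩ := exists_norm_symbol_le hs hm hh
  obtain ⟨A, hA0, hA⟩ := hb 0
  obtain ⟨P, hP⟩ := exists_nat_gt ((Module.finrank ℝ V : ℝ) + s)
  obtain ⟨B, hB0, hB⟩ := norm_iteratedFDeriv_symbol_dilate_le hN hb ψ P
  obtain ⟨D, hD0, hD⟩ := norm_iteratedFDeriv_dilate_le ψ 0
  have hNt : N.HasTemperateGrowth := by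
    refine ⟨hN, fun k => ?_⟩
    obtain ⟨C, hC0, hC⟩ := hb k
    obtain ⟨q, hq⟩ := exists_nat_gt s
    refine ⟨q, C, fun x => (hC x).trans ?_⟩
    rw [← Real.rpow_natCast]
    gcongr
    · linarith [norm_nonneg x]
    · have : (0 : ℝ) ≤ k := k.cast_nonneg
      linarith
  let K : ℝ := (M + A * 2 ^ s) * D
  have hball : Integrable (Set.indicator (Metric.ball (0 : V) 1) fun _ => K) :=
    (integrable_indicator_iff measurableSet_ball).mpr
      (integrableOn_const measure_ball_lt_top.ne)
  have hint := integrable_one_add_norm (μ := (volume : Measure V)) (r := P - s)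
    (by linarith)
  refine ⟨(∫ v, Set.indicator (Metric.ball (0 : V) 1) (fun _ => K) v) +
    ∫ v : V, B * (1 + ‖v‖) ^ (-((P : ℝ) - s)), ?_, fun t ht ht1 θ hθ => ?_⟩
  · apply add_nonneg
    · exact integral_nonneg fun v => Set.indicator_nonneg (fun _ _ => by positivity) v
    · exact integral_nonneg fun v => by positivity
  let ψt : 𝓢(V, F) := compCLMOfContinuousLinearEquiv ℝ
    (ContinuousLinearEquiv.smulLeft (Units.mk0 t ht.ne')) ψ
  have hψt : ∀ η, ψt η = ψ (t • η) := fun η => rfl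
  let g : 𝓢(V, F) := smulLeftCLM F N ψt
  have hg : ∀ η, g η = N η • ψ (t • η) := fun η => by
    rw [smulLeftCLM_apply_apply hNt, hψt]
  have hsplit : (fun η => m η • ψ (t • η)) =
      (fun η => (m η - N η) • ψ (t • η)) + fun η => g η := by
    ext η; simp [hg, sub_smul]
  have hebound : ∀ η, ‖(m η - N η) • ψ (t • η)‖ ≤
      Set.indicator (Metric.ball (0 : V) 1) (fun _ => K) η := by
    intro η
    by_cases h : 1 / 2 ≤ ‖η‖
    · rw [hNm η h, sub_self, zero_smul, norm_zero]
      exact Set.indicator_nonneg (fun _ _ => by positivity) η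
    · push Not at h
      rw [Set.indicator_of_mem (by simp; linarith)]
      have h1 := hM η
      have h2 := hA η
      have h3 := hD t ht ht1 η
      rw [norm_iteratedFDeriv_zero] at h2 h3
      simp only [pow_zero, div_one, CharP.cast_eq_zero, sub_zero] at h2 h3
      have h4 : ‖η‖ ^ s ≤ 1 := Real.rpow_le_one (norm_nonneg _) (by linarith) hs.le
      have h5 : (1 + ‖η‖) ^ s ≤ 2 ^ s := by gcongr; linarith
      rw [norm_smul]
      have h6 : ‖m η - N η‖ ≤ M + A * 2 ^ s := by
        refine (norm_sub_le _ _).trans (add_le_add ?_ ?_)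
        · exact h1.trans (mul_le_of_le_one_right hM0 h4)
        · exact h2.trans (by gcongr)
      exact mul_le_mul h6 h3 (norm_nonneg _) (by positivity)
  have heint : Integrable (fun η => (m η - N η) • ψ (t • η)) :=
    hball.mono' ((hcont.sub hN.continuous).smul ψt.continuous).aestronglyMeasurable
      (Eventually.of_forall hebound)
  rw [hsplit]
  have hadd : 𝓕 ((fun η => (m η - N η) • ψ (t • η)) + fun η => g η) θ =
      𝓕 (fun η => (m η - N η) • ψ (t • η)) θ + 𝓕 (fun η => g η) θ := by
    rw [Real.fourier_eq, Real.fourier_eq, Real.fourier_eq, ← integral_add]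
    · simp [smul_add]
    · exact (Real.fourierIntegral_convergent_iff θ).mpr heint
    · exact (Real.fourierIntegral_convergent_iff θ).mpr g.integrable
  rw [hadd]
  refine (norm_add_le _ _).trans (add_le_add ?_ ?_)
  · exact (norm_fourier_le_integral _ _).trans
      (integral_mono_of_nonneg (Eventually.of_forall fun _ => norm_nonneg _) hball
        (Eventually.of_forall hebound))
  · refine (norm_fourier_schwartz_le g P θ hθ).trans
      (integral_mono_of_nonneg (Eventually.of_forall fun _ => norm_nonneg _) (hint.const_mul B)
        (Eventually.of_forall fun v => ?_))
    have h1 := hB t ht ht1 v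
    have h2 : (g : V → F) = fun y => N y • ψ (t • y) := funext hg
    simp only [h2]
    rwa [neg_sub]

theorem fourier_symbol_decay {s : ℝ} (hs : 0 < s) {m : V → ℂ}
    (hm : ∀ ξ, ξ ≠ 0 → ContDiffAt ℝ ∞ m ξ)
    (hh : ∀ t : ℝ, 0 < t → ∀ ξ, m (t • ξ) = (t ^ s) • m ξ) (ψ : 𝓢(V, F)) :
    ∃ C, ∀ w, (1 + ‖w‖ ^ ((Module.finrank ℝ V : ℝ) + s)) *
      ‖𝓕 (fun ξ => m ξ • ψ ξ) w‖ ≤ C := by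
  obtain ⟨C, hC0, hC⟩ := norm_fourier_symbol_dilate_le hs hm hh ψ
  set d : ℝ := (Module.finrank ℝ V : ℝ)
  have hds : 0 ≤ d + s := by positivity
  set J := ∫ v, ‖m v • ψ v‖
  have hJ : 0 ≤ J := integral_nonneg fun _ => norm_nonneg _
  refine ⟨2 * J + C, fun w => ?_⟩
  have h0 : ‖𝓕 (fun ξ => m ξ • ψ ξ) w‖ ≤ J := norm_fourier_le_integral _ w
  rcases le_total ‖w‖ 1 with h | h
  · have h1 : ‖w‖ ^ (d + s) ≤ 1 := Real.rpow_le_one (norm_nonneg _) h hds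
    calc _ ≤ (1 + 1) * J := by gcongr
      _ ≤ _ := by linarith
  · have hr0 : 0 < ‖w‖ := by linarith
    set t := ‖w‖⁻¹ with ht
    have ht0 : 0 < t := by positivity
    have hθ : ‖t • w‖ = 1 := by
      rw [norm_smul, ht, norm_inv, norm_norm]; field_simp
    have e : 𝓕 (fun η => m η • ψ (t • η)) (t • w) =
        ((‖w‖ ^ (d + s) : ℝ)) • 𝓕 (fun ξ => m ξ • ψ ξ) w := by
      rw [Real.fourier_eq, Real.fourier_eq]
      have := Measure.integral_comp_smul (volume : Measure V)
        (fun v => Real.fourierChar (-(inner ℝ v w)) • m v • ψ v) t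
      have h2 : ∀ v : V, Real.fourierChar (-(inner ℝ (t • v) w)) • m (t • v) • ψ (t • v) =
          (t ^ s) • (Real.fourierChar (-(inner ℝ v (t • w))) • m v • ψ (t • v)) := by
        intro v
        rw [hh t ht0, real_inner_smul_left, real_inner_smul_right]
        simp only [Circle.smul_def, smul_smul, ← Complex.coe_smul]
        congr 1
        ring
      simp only [h2] at this
      rw [integral_smul] at this
      have h3 := congrArg (fun z => (‖w‖ ^ s : ℝ) • z) this
      simp only [smul_smul] at h3
      have h4 : ‖w‖ ^ s * t ^ s = 1 := by
        rw [← Real.mul_rpow hr0.le ht0.le, ht, mul_inv_cancel₀ hr0.ne', Real.one_rpow]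
      rw [h4, one_smul] at h3
      rw [h3]
      congr 1
      rw [ht, inv_pow, inv_inv, abs_of_nonneg (by positivity), Real.rpow_add hr0,
        Real.rpow_natCast, mul_comm]
    have h1 := hC t ht0 (inv_le_one_of_one_le₀ h) (t • w) hθ
    rw [e, norm_smul, Real.norm_of_nonneg (by positivity)] at h1
    linarith

theorem fourier_symbol_smooth_decay {s : ℝ} (hs : 0 < s) {m : V → ℂ}
    (hm : ∀ ξ, ξ ≠ 0 → ContDiffAt ℝ ∞ m ξ)
    (hh : ∀ t : ℝ, 0 < t → ∀ ξ, m (t • ξ) = (t ^ s) • m ξ) (ψ : 𝓢(V, F)) :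
    ContDiff ℝ ∞ (𝓕 (fun ξ => m ξ • ψ ξ)) ∧ ∀ k : ℕ, ∃ C, ∀ w,
      (1 + ‖w‖ ^ ((Module.finrank ℝ V : ℝ) + s)) *
        ‖iteratedFDeriv ℝ k (𝓕 (fun ξ => m ξ • ψ ξ)) w‖ ≤ C := by
  have hint := integrable_pow_mul_symbol_smul hs hm hh ψ
  refine ⟨Real.contDiff_fourier (N := ⊤) fun n _ => hint n, fun k => ?_⟩
  let ψk : 𝓢(V, V [×k]→L[ℝ] F) :=
    { toFun := fun v => VectorFourier.fourierPowSMulRight (innerSL ℝ) ψ v k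
      smooth' := (ψ.smooth ⊤).fourierPowSMulRight _ k
      decay' := by
        intro a j
        let S : ℝ := ∑ i ∈ Finset.range (j + 1), ∑ l ∈ Finset.range (k + 1),
          SchwartzMap.seminorm ℝ (a + l) i ψ
        refine ⟨(2 * Real.pi) ^ k * (2 * k + 2) ^ j * ‖innerSL (E := V) ℝ‖ ^ k * S, fun v => ?_⟩
        have h := VectorFourier.norm_iteratedFDeriv_fourierPowSMulRight (innerSL (E := V) ℝ)
          (f := ψ) (K := ∞) (n := k) (k := j) (v := v)
          (C := ∑ i ∈ Finset.range (j + 1), ∑ l ∈ Finset.range (k + 1),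
            ‖v‖ ^ l * ‖iteratedFDeriv ℝ i ψ v‖) (ψ.smooth ⊤) (by exact_mod_cast le_top) (by
              intro i hi l hl
              refine le_trans ?_ (Finset.single_le_sum (f := fun i => ∑ l ∈ Finset.range (k + 1),
                ‖v‖ ^ l * ‖iteratedFDeriv ℝ i ψ v‖) (fun _ _ => by positivity)
                (Finset.mem_range.mpr (Nat.lt_succ_of_le hi)))
              exact Finset.single_le_sum (f := fun l => ‖v‖ ^ l * ‖iteratedFDeriv ℝ i ψ v‖)
                (fun _ _ => by positivity) (Finset.mem_range.mpr (Nat.lt_succ_of_le hl)))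
        have h2 : ‖v‖ ^ a * (∑ i ∈ Finset.range (j + 1), ∑ l ∈ Finset.range (k + 1),
            ‖v‖ ^ l * ‖iteratedFDeriv ℝ i ψ v‖) ≤ S := by
          simp only [Finset.mul_sum, ← mul_assoc, ← pow_add]
          exact Finset.sum_le_sum fun i _ => Finset.sum_le_sum fun l _ =>
            SchwartzMap.le_seminorm ℝ (a + l) i ψ v
        refine (mul_le_mul_of_nonneg_left h (by positivity)).trans ?_
        rw [mul_left_comm]
        exact mul_le_mul_of_nonneg_left h2 (by positivity) }
  rw [Real.iteratedFDeriv_fourier (N := ⊤) (fun n _ => hint n)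
    (integrable_symbol_smul hs hm hh ψ).aestronglyMeasurable le_top]
  have e : (fun v => VectorFourier.fourierPowSMulRight (innerSL ℝ) (fun ξ => m ξ • ψ ξ) v k) =
      fun v => m v • ψk v := by
    ext v u
    simp only [smul_apply]
    change _ = m v • (VectorFourier.fourierPowSMulRight (innerSL ℝ) ψ v k) u
    rw [VectorFourier.fourierPowSMulRight_apply, VectorFourier.fourierPowSMulRight_apply]
    rw [smul_comm (m v), smul_comm (m v)]
  rw [e]
  exact fourier_symbol_decay hs hm hh ψk

end decay

noncomputable section

section defs

variable (𝕜 : Type*) [RCLike 𝕜] (n : ℕ) (s : ℝ)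

/-- The space `𝒮_s` as a space of functions: smooth functions on `ℝⁿ` all of whose derivatives are
`O((1 + |x|^(n+s))⁻¹)`. -/
def testSubmodule : Submodule 𝕜 (EuclideanSpace ℝ (Fin n) → 𝕜) where
  carrier := {f | ContDiff ℝ ∞ f ∧
    ∀ k : ℕ, ∃ C : ℝ, ∀ x, (1 + ‖x‖ ^ ((n : ℝ) + s)) * ‖iteratedFDeriv ℝ k f x‖ ≤ C}
  zero_mem' := by
    refine ⟨contDiff_const, fun k => ⟨0, fun x => ?_⟩⟩
    have : iteratedFDeriv ℝ k (0 : EuclideanSpace ℝ (Fin n) → 𝕜) = 0 := iteratedFDeriv_fun_zero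
    simp [this]
  add_mem' := by
    rintro f g ⟨hf, hf'⟩ ⟨hg, hg'⟩
    refine ⟨hf.add hg, fun k => ?_⟩
    obtain ⟨C, hC⟩ := hf' k
    obtain ⟨D, hD⟩ := hg' k
    refine ⟨C + D, fun x => ?_⟩
    rw [iteratedFDeriv_add_apply (hf.of_le (by exact_mod_cast le_top)).contDiffAt
      (hg.of_le (by exact_mod_cast le_top)).contDiffAt]
    refine le_trans ?_ (add_le_add (hC x) (hD x))
    rw [← mul_add]
    gcongr
    exact norm_add_le _ _
  smul_mem' := by
    rintro c f ⟨hf, hf'⟩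
    refine ⟨hf.const_smul c, fun k => ?_⟩
    obtain ⟨C, hC⟩ := hf' k
    refine ⟨‖c‖ * C, fun x => ?_⟩
    rw [iteratedFDeriv_const_smul_apply (hf.of_le (by exact_mod_cast le_top)).contDiffAt,
      norm_smul, mul_left_comm]
    gcongr
    exact hC x

/-- The space `𝒮_s`, a type of its own so that it carries its seminorm topology and not the
topology of pointwise convergence. -/
def TestSpace : Type _ := ↥(testSubmodule 𝕜 n s)

instance : AddCommGroup (TestSpace 𝕜 n s) := inferInstanceAs (AddCommGroup ↥(testSubmodule 𝕜 n s))

instance : Module 𝕜 (TestSpace 𝕜 n s) := inferInstanceAs (Module 𝕜 ↥(testSubmodule 𝕜 n s))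

instance : CoeFun (TestSpace 𝕜 n s) fun _ => EuclideanSpace ℝ (Fin n) → 𝕜 := ⟨Subtype.val⟩

variable {𝕜 n s}

theorem TestSpace.bddAbove (k : ℕ) (f : TestSpace 𝕜 n s) :
    BddAbove (Set.range fun x => (1 + ‖x‖ ^ ((n : ℝ) + s)) * ‖iteratedFDeriv ℝ k f x‖) := by
  obtain ⟨C, hC⟩ := f.2.2 k
  exact ⟨C, by rintro _ ⟨x, rfl⟩; exact hC x⟩

variable (𝕜 n s)

/-- The `k`-th seminorm of `𝒮_s`: `sup_x (1 + |x|^(n+s)) |Dᵏ f(x)|`. -/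
def testSeminorm (k : ℕ) : Seminorm 𝕜 (TestSpace 𝕜 n s) where
  toFun f := ⨆ x, (1 + ‖x‖ ^ ((n : ℝ) + s)) * ‖iteratedFDeriv ℝ k f x‖
  map_zero' := by
    have : iteratedFDeriv ℝ k ((0 : TestSpace 𝕜 n s) : EuclideanSpace ℝ (Fin n) → 𝕜) = 0 :=
      iteratedFDeriv_fun_zero
    simp [this]
  add_le' f g := by
    refine ciSup_le fun x => ?_
    have e : ((f + g : TestSpace 𝕜 n s) : EuclideanSpace ℝ (Fin n) → 𝕜) = f.1 + g.1 := rfl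
    rw [e, iteratedFDeriv_add_apply (f.2.1.of_le (by exact_mod_cast le_top)).contDiffAt
      (g.2.1.of_le (by exact_mod_cast le_top)).contDiffAt]
    refine le_trans ?_ (add_le_add (le_ciSup (TestSpace.bddAbove k f) x)
      (le_ciSup (TestSpace.bddAbove k g) x))
    rw [← mul_add]
    gcongr
    exact norm_add_le _ _
  neg' f := by
    have e : ((-f : TestSpace 𝕜 n s) : EuclideanSpace ℝ (Fin n) → 𝕜) = -f.1 := rfl
    simp only [e, iteratedFDeriv_neg, Pi.neg_apply, norm_neg]
  smul' c f := by
    have e : ((c • f : TestSpace 𝕜 n s) : EuclideanSpace ℝ (Fin n) → 𝕜) = c • f.1 := rfl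
    simp only [e]
    rw [Real.mul_iSup_of_nonneg (norm_nonneg c)]
    congr 1
    ext x
    rw [iteratedFDeriv_const_smul_apply (f.2.1.of_le (by exact_mod_cast le_top)).contDiffAt,
      norm_smul, mul_left_comm]

/-- The locally convex topology of `𝒮_s`. -/
instance : TopologicalSpace (TestSpace 𝕜 n s) :=
  (show SeminormFamily 𝕜 (TestSpace 𝕜 n s) ℕ from testSeminorm 𝕜 n s).moduleFilterBasis.topology'

theorem testSpace_withSeminorms :
    WithSeminorms (show SeminormFamily 𝕜 (TestSpace 𝕜 n s) ℕ from testSeminorm 𝕜 n s) := ⟨rfl⟩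

/-- The space of distributions `𝒮_s'`, the topological dual of `𝒮_s`. -/
abbrev TestDual : Type _ := TestSpace 𝕜 n s →L[𝕜] 𝕜

variable {𝕜 n s}

/-- The Schwartz function `φ` regarded as a complex-valued one. -/
def toComplex (φ : 𝓢(EuclideanSpace ℝ (Fin n), 𝕜)) : 𝓢(EuclideanSpace ℝ (Fin n), ℂ) :=
  postcompCLM (𝕜 := ℝ) (RCLike.map 𝕜 ℂ) φ

/-- The Fourier multiplier operator with symbol `m`, that is `φ ↦ (m φ̂)^∨`. Here
`φ̂(ξ) = ∫ φ(x) e^(-2πi x·ξ) dx`. For `𝕜 = ℝ` the outer `RCLike.map ℂ 𝕜` is the real part; for the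
symbols below, `m(-ξ)` is the conjugate of `m(ξ)` and the inverse transform is real anyway. -/
def multiplier (m : EuclideanSpace ℝ (Fin n) → ℂ) (φ : 𝓢(EuclideanSpace ℝ (Fin n), 𝕜)) :
    EuclideanSpace ℝ (Fin n) → 𝕜 :=
  fun x => RCLike.map ℂ 𝕜 (𝓕⁻ (fun ξ => m ξ * (𝓕 (toComplex φ) : 𝓢(EuclideanSpace ℝ (Fin n), ℂ)) ξ) x)

/-- The symbol `(2π|ξ|)^σ` of `(-Δ)^(σ/2)`. -/
def laplaceSymbol (n : ℕ) (σ : ℝ) (ξ : EuclideanSpace ℝ (Fin n)) : ℂ :=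
  (((2 * Real.pi * ‖ξ‖) ^ σ : ℝ) : ℂ)

/-- The symbol `(-2πi ξ_j)(2π|ξ|)^(s-1)` of the `j`-th component of `∇ˢ₋`. -/
def gradSymbol (n : ℕ) (s : ℝ) (j : Fin n) (ξ : EuclideanSpace ℝ (Fin n)) : ℂ :=
  -2 * Real.pi * Complex.I * (ξ j : ℂ) * (((2 * Real.pi * ‖ξ‖) ^ (s - 1) : ℝ) : ℂ)

theorem laplaceSymbol_contDiffAt (σ : ℝ) (ξ : EuclideanSpace ℝ (Fin n)) (hξ : ξ ≠ 0) :
    ContDiffAt ℝ ∞ (laplaceSymbol n σ) ξ := by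
  have h : (2 * Real.pi * ‖ξ‖) ≠ 0 := by
    have := norm_pos_iff.mpr hξ
    have := Real.pi_pos
    positivity
  exact Complex.ofRealCLM.contDiff.contDiffAt.comp ξ
    ((contDiffAt_const.mul (contDiffAt_norm ℝ hξ)).rpow_const_of_ne h)

theorem laplaceSymbol_smul (σ t : ℝ) (ht : 0 < t) (ξ : EuclideanSpace ℝ (Fin n)) :
    laplaceSymbol n σ (t • ξ) = (t ^ σ) • laplaceSymbol n σ ξ := by
  have := Real.pi_pos
  rw [laplaceSymbol, laplaceSymbol, norm_smul, Real.norm_of_nonneg ht.le,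
    show 2 * Real.pi * (t * ‖ξ‖) = t * (2 * Real.pi * ‖ξ‖) by ring,
    Real.mul_rpow ht.le (by positivity), Complex.real_smul]
  push_cast
  rfl

theorem gradSymbol_contDiffAt (j : Fin n) (ξ : EuclideanSpace ℝ (Fin n)) (hξ : ξ ≠ 0) :
    ContDiffAt ℝ ∞ (gradSymbol n s j) ξ := by
  have h1 : ContDiff ℝ ∞ fun ξ : EuclideanSpace ℝ (Fin n) => ((ξ j : ℝ) : ℂ) :=
    (Complex.ofRealCLM.comp (EuclideanSpace.proj (𝕜 := ℝ) j)).contDiff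
  exact (contDiffAt_const.mul h1.contDiffAt).mul (laplaceSymbol_contDiffAt (s - 1) ξ hξ)

theorem gradSymbol_smul (j : Fin n) (t : ℝ) (ht : 0 < t) (ξ : EuclideanSpace ℝ (Fin n)) :
    gradSymbol n s j (t • ξ) = (t ^ s) • gradSymbol n s j ξ := by
  have h := laplaceSymbol_smul (s - 1) t ht ξ
  simp only [laplaceSymbol, Complex.real_smul] at h
  rw [gradSymbol, gradSymbol, h, Complex.real_smul]
  have e : ((t ^ s : ℝ) : ℂ) = ((t : ℝ) : ℂ) * ((t ^ (s - 1) : ℝ) : ℂ) := by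
    rw [← Complex.ofReal_mul]
    congr 1
    rw [Real.rpow_sub_one ht.ne']
    field_simp
  rw [e]
  simp
  ring

theorem multiplier_mem (hs : 0 < s) {m : EuclideanSpace ℝ (Fin n) → ℂ}
    (hm : ∀ ξ, ξ ≠ 0 → ContDiffAt ℝ ∞ m ξ)
    (hh : ∀ t : ℝ, 0 < t → ∀ ξ, m (t • ξ) = (t ^ s) • m ξ)
    (φ : 𝓢(EuclideanSpace ℝ (Fin n), 𝕜)) : multiplier m φ ∈ testSubmodule 𝕜 n s := by
  obtain ⟨h1, h2⟩ := fourier_symbol_smooth_decay hs hm hh (𝓕 (toComplex φ))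
  set G : EuclideanSpace ℝ (Fin n) → ℂ := 𝓕 (fun ξ => m ξ • (𝓕 (toComplex φ) : 𝓢(EuclideanSpace ℝ (Fin n), ℂ)) ξ) with hG
  have e : multiplier m φ = RCLike.map ℂ 𝕜 ∘ (G ∘ LinearIsometryEquiv.neg ℝ) := by
    ext x
    simp only [multiplier, Function.comp, hG]
    rw [Real.fourierInv_eq_fourier_neg]
    rfl
  have h3 : ContDiff ℝ ∞ (G ∘ LinearIsometryEquiv.neg ℝ) :=
    h1.comp (LinearIsometryEquiv.neg ℝ).contDiff
  rw [e]
  refine ⟨(RCLike.map ℂ 𝕜).contDiff.comp h3, fun k => ?_⟩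
  obtain ⟨C, hC⟩ := h2 k
  rw [finrank_euclideanSpace_fin] at hC
  refine ⟨‖RCLike.map ℂ 𝕜‖ * C, fun x => ?_⟩
  have h4 := (RCLike.map ℂ 𝕜).norm_iteratedFDeriv_comp_left (x := x) h3.contDiffAt
    (n := k) (by exact_mod_cast le_top)
  rw [LinearIsometryEquiv.norm_iteratedFDeriv_comp_right] at h4
  have h5 := hC (LinearIsometryEquiv.neg ℝ x)
  rw [LinearIsometryEquiv.norm_map] at h5
  refine (mul_le_mul_of_nonneg_left h4 (by positivity)).trans ?_
  rw [mul_left_comm]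
  gcongr

/-- `∇ˢ₊ φ = (-Δ)^(s/2) φ` for a Schwartz function `φ`, an element of `𝒮_s`. -/
def gradPlusTest (hs : 0 < s) (φ : 𝓢(EuclideanSpace ℝ (Fin n), 𝕜)) : TestSpace 𝕜 n s :=
  ⟨multiplier (laplaceSymbol n s) φ, multiplier_mem hs (laplaceSymbol_contDiffAt s)
    (fun t ht => laplaceSymbol_smul s t ht) φ⟩

/-- `∇ˢ_j φ`, the `j`-th component of `∇ˢ₋ φ`, for a Schwartz function `φ`. -/
def gradMinusTest (hs : 0 < s) (j : Fin n) (φ : 𝓢(EuclideanSpace ℝ (Fin n), 𝕜)) :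
    TestSpace 𝕜 n s :=
  ⟨multiplier (gradSymbol n s j) φ, multiplier_mem hs (gradSymbol_contDiffAt j)
    (fun t ht => gradSymbol_smul j t ht) φ⟩

/-- The distribution `∇ˢ₊ u` for `u ∈ 𝒮_s'`: `⟨∇ˢ₊ u, φ⟩ = ⟨u, ∇ˢ₊ φ⟩`. -/
def gradPlus (hs : 0 < s) (u : TestDual 𝕜 n s) (φ : 𝓢(EuclideanSpace ℝ (Fin n), 𝕜)) : 𝕜 :=
  u (gradPlusTest hs φ)

/-- The vector-valued distribution `∇ˢ₋ u` for `u ∈ 𝒮_s'`: `⟨∇ˢ_j u, φ⟩ = -⟨u, ∇ˢ_j φ⟩`. -/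
def gradMinus (hs : 0 < s) (u : TestDual 𝕜 n s) (φ : 𝓢(EuclideanSpace ℝ (Fin n), 𝕜)) :
    EuclideanSpace 𝕜 (Fin n) :=
  WithLp.toLp 2 fun j => -u (gradMinusTest hs j φ)

/-- The extended `L¹` norm of a (scalar or vector) distribution `T`: it is `∫ |h|` if `T` is
represented by an integrable function `h`, which is then unique up to null sets, and `∞` if `T` is
not represented by an integrable function. -/
def distL1Norm {F : Type*} [NormedAddCommGroup F] [NormedSpace ℝ F] [Module 𝕜 F]
    (T : 𝓢(EuclideanSpace ℝ (Fin n), 𝕜) → F) : ℝ≥0∞ :=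
  ⨅ (h : EuclideanSpace ℝ (Fin n) → F) (_ : Integrable h) (_ : ∀ φ, T φ = ∫ x, φ x • h x),
    ∫⁻ x, ‖h x‖ₑ

theorem distL1Norm_lt_top {F : Type*} [NormedAddCommGroup F] [NormedSpace ℝ F] [Module 𝕜 F]
    {T : 𝓢(EuclideanSpace ℝ (Fin n), 𝕜) → F} : distL1Norm T < ⊤ ↔
      ∃ h : EuclideanSpace ℝ (Fin n) → F, Integrable h ∧ ∀ φ, T φ = ∫ x, φ x • h x := by
  simp only [distL1Norm, iInf_lt_top]
  constructor
  · rintro ⟨h, h1, h2, -⟩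
    exact ⟨h, h1, h2⟩
  · rintro ⟨h, h1, h2⟩
    exact ⟨h, h1, h2, h1.2⟩

theorem integrable_schwartz_smul {F : Type*} [NormedAddCommGroup F] [NormedSpace ℝ F]
    [NormedSpace 𝕜 F] (φ : 𝓢(EuclideanSpace ℝ (Fin n), 𝕜)) {h : EuclideanSpace ℝ (Fin n) → F}
    (hh : Integrable h) : Integrable fun x => φ x • h x := by
  refine hh.bdd_smul (SchwartzMap.seminorm ℝ 0 0 φ) φ.continuous.aestronglyMeasurable
    (Eventually.of_forall fun x => ?_)
  exact SchwartzMap.norm_le_seminorm ℝ φ x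

theorem distL1Norm_add_lt_top {F : Type*} [NormedAddCommGroup F] [NormedSpace ℝ F]
    [NormedSpace 𝕜 F] {S T U : 𝓢(EuclideanSpace ℝ (Fin n), 𝕜) → F} (hS : distL1Norm S < ⊤)
    (hT : distL1Norm T < ⊤) (hU : ∀ φ, U φ = S φ + T φ) : distL1Norm U < ⊤ := by
  rw [distL1Norm_lt_top] at *
  obtain ⟨g, hg, hg'⟩ := hS
  obtain ⟨h, hh, hh'⟩ := hT
  refine ⟨g + h, hg.add hh, fun φ => ?_⟩
  rw [hU, hg', hh', ← integral_add (integrable_schwartz_smul φ hg) (integrable_schwartz_smul φ hh)]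
  simp [smul_add]

theorem distL1Norm_smul_lt_top {F : Type*} [NormedAddCommGroup F] [NormedSpace ℝ F]
    [NormedSpace 𝕜 F] [SMulCommClass ℝ 𝕜 F] {S U : 𝓢(EuclideanSpace ℝ (Fin n), 𝕜) → F} (c : 𝕜)
    (hS : distL1Norm S < ⊤) (hU : ∀ φ, U φ = c • S φ) : distL1Norm U < ⊤ := by
  rw [distL1Norm_lt_top] at *
  obtain ⟨g, hg, hg'⟩ := hS
  refine ⟨c • g, hg.smul c, fun φ => ?_⟩
  rw [hU, hg', ← integral_smul]
  simp [smul_comm c]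

theorem distL1Norm_zero_lt_top {F : Type*} [NormedAddCommGroup F] [NormedSpace ℝ F]
    [NormedSpace 𝕜 F] {U : 𝓢(EuclideanSpace ℝ (Fin n), 𝕜) → F}
    (hU : ∀ φ, U φ = 0) : distL1Norm U < ⊤ := by
  rw [distL1Norm_lt_top]
  exact ⟨0, integrable_zero _ _ _, fun φ => by simp [hU]⟩

/-- The seminorm `[u]_{H^{s,1}_+} = ‖∇ˢ₊ u‖_{L¹}`, with value `∞` off `H^{s,1}_+`. -/
def normPlus (hs : 0 < s) (u : TestDual 𝕜 n s) : ℝ≥0∞ := distL1Norm (gradPlus hs u)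

/-- The seminorm `[u]_{H^{s,1}_-} = ‖∇ˢ₋ u‖_{L¹}`, with value `∞` off `H^{s,1}_-`. -/
def normMinus (hs : 0 < s) (u : TestDual 𝕜 n s) : ℝ≥0∞ := distL1Norm (gradMinus hs u)

variable (𝕜 n)

/-- The space `H^{s,1}_+`. -/
def HPlus (hs : 0 < s) : Submodule 𝕜 (TestDual 𝕜 n s) where
  carrier := {u | normPlus hs u < ⊤}
  zero_mem' := distL1Norm_zero_lt_top fun _ => rfl
  add_mem' hu hv := distL1Norm_add_lt_top hu hv fun _ => rfl
  smul_mem' c _ hu := distL1Norm_smul_lt_top c hu fun _ => rfl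

/-- The space `H^{s,1}_-`. -/
def HMinus (hs : 0 < s) : Submodule 𝕜 (TestDual 𝕜 n s) where
  carrier := {u | normMinus hs u < ⊤}
  zero_mem' := distL1Norm_zero_lt_top fun φ => by ext j; simp [gradMinus]
  add_mem' hu hv := distL1Norm_add_lt_top hu hv fun φ => by ext j; simp [gradMinus]; ring
  smul_mem' c _ hu := distL1Norm_smul_lt_top c hu fun φ => by ext j; simp [gradMinus]

variable {𝕜 n}

theorem integrable_laplaceSymbol_neg_mul (hs : 0 < s) (hsn : s < n)
    (ψ : 𝓢(EuclideanSpace ℝ (Fin n), ℂ)) :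
    Integrable fun ξ => laplaceSymbol n (-s) ξ * ψ ξ := by
  have hpi := Real.pi_pos
  have hmeas : Measurable (laplaceSymbol n (-s)) := by
    unfold laplaceSymbol
    fun_prop
  have hn : ∀ ξ : EuclideanSpace ℝ (Fin n),
      ‖laplaceSymbol n (-s) ξ‖ = (2 * Real.pi) ^ (-s) * ‖ξ‖ ^ (-s) := by
    intro ξ
    rw [laplaceSymbol, Complex.norm_real, Real.norm_of_nonneg (by positivity),
      Real.mul_rpow (by positivity) (by positivity)]
  have hae : AEStronglyMeasurable fun ξ => laplaceSymbol n (-s) ξ * ψ ξ :=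
    hmeas.aestronglyMeasurable.mul ψ.continuous.aestronglyMeasurable
  have hψ : ∀ ξ, ‖ψ ξ‖ ≤ SchwartzMap.seminorm ℝ 0 0 ψ := fun ξ =>
    SchwartzMap.norm_le_seminorm ℝ ψ ξ
  have h1 : IntegrableOn (fun ξ => laplaceSymbol n (-s) ξ * ψ ξ) (Metric.ball 0 1) := by
    refine integrableOn_ball_of_norm_le_rpow (α := s)
      (C := (2 * Real.pi) ^ (-s) * SchwartzMap.seminorm ℝ 0 0 ψ) ?_ ?_ ?_ hae
    · rw [finrank_euclideanSpace_fin]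
      have : (0 : ℝ) < n := hs.trans hsn
      exact_mod_cast this
    · rwa [finrank_euclideanSpace_fin]
    · refine Eventually.of_forall fun ξ => ?_
      rw [norm_mul, hn, mul_right_comm]
      gcongr
      exact hψ ξ
  have h2 : IntegrableOn (fun ξ => laplaceSymbol n (-s) ξ * ψ ξ) (Metric.ball 0 1)ᶜ := by
    refine Integrable.mono' (ψ.integrable.norm.const_mul ((2 * Real.pi) ^ (-s))).integrableOn
      hae.restrict ?_
    refine (ae_restrict_mem measurableSet_ball.compl).mono fun ξ hξ => ?_
    rw [norm_mul, hn]
    gcongr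
    refine mul_le_of_le_one_right (by positivity) ?_
    refine Real.rpow_le_one_of_one_le_of_nonpos ?_ (by linarith)
    simpa using hξ
  rw [← integrableOn_univ, ← Set.union_compl_self (Metric.ball (0 : EuclideanSpace ℝ (Fin n)) 1)]
  exact h1.union h2

theorem TestSpace.norm_le (hs : 0 < s) (f : TestSpace 𝕜 n s) (x : EuclideanSpace ℝ (Fin n)) :
    ‖f x‖ ≤ testSeminorm 𝕜 n s 0 f * (2 ^ ((n : ℝ) + s) * (1 + ‖x‖) ^ (-((n : ℝ) + s))) := by
  have h : (1 + ‖x‖ ^ ((n : ℝ) + s)) * ‖iteratedFDeriv ℝ 0 f x‖ ≤ testSeminorm 𝕜 n s 0 f :=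
    le_ciSup (TestSpace.bddAbove 0 f) x
  rw [norm_iteratedFDeriv_zero] at h
  have hr : 0 ≤ (n : ℝ) + s := by positivity
  have h1 : (0 : ℝ) < 1 + ‖x‖ := by positivity
  have h2 : (1 + ‖x‖) ^ ((n : ℝ) + s) ≤ 2 ^ ((n : ℝ) + s) * (1 + ‖x‖ ^ ((n : ℝ) + s)) := by
    rcases le_total ‖x‖ 1 with hx | hx
    · calc _ ≤ (2 : ℝ) ^ ((n : ℝ) + s) := by gcongr; linarith
        _ ≤ _ := le_mul_of_one_le_right (by positivity) (by
          have : 0 ≤ ‖x‖ ^ ((n : ℝ) + s) := by positivity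
          linarith)
    · calc _ ≤ (2 * ‖x‖) ^ ((n : ℝ) + s) := by gcongr; linarith
        _ = 2 ^ ((n : ℝ) + s) * ‖x‖ ^ ((n : ℝ) + s) := Real.mul_rpow (by norm_num) (by positivity)
        _ ≤ _ := by gcongr; linarith
  rw [Real.rpow_neg h1.le, ← div_eq_mul_inv, ← mul_div_assoc, le_div_iff₀ (by positivity)]
  calc _ ≤ ‖f x‖ * (2 ^ ((n : ℝ) + s) * (1 + ‖x‖ ^ ((n : ℝ) + s))) := by gcongr
    _ = ((1 + ‖x‖ ^ ((n : ℝ) + s)) * ‖f x‖) * 2 ^ ((n : ℝ) + s) := by ring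
    _ ≤ _ := by gcongr

theorem TestSpace.integrable (hs : 0 < s) (f : TestSpace 𝕜 n s) :
    Integrable (f : EuclideanSpace ℝ (Fin n) → 𝕜) := by
  have h := integrable_one_add_norm (μ := (volume : Measure (EuclideanSpace ℝ (Fin n))))
    (r := (n : ℝ) + s) (by rw [finrank_euclideanSpace_fin]; linarith)
  exact ((h.const_mul (2 ^ ((n : ℝ) + s))).const_mul (testSeminorm 𝕜 n s 0 f)).mono'
    f.2.1.continuous.aestronglyMeasurable (Eventually.of_forall (f.norm_le hs))

/-- The Riesz potential `I_s φ = (-Δ)^(-s/2) φ` of a Schwartz function `φ`, as a function. -/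
def rieszFun (s : ℝ) (φ : 𝓢(EuclideanSpace ℝ (Fin n), 𝕜)) : EuclideanSpace ℝ (Fin n) → 𝕜 :=
  multiplier (laplaceSymbol n (-s)) φ

theorem rieszFun_continuous_bounded (hs : 0 < s) (hsn : s < n)
    (φ : 𝓢(EuclideanSpace ℝ (Fin n), 𝕜)) :
    Continuous (rieszFun s φ) ∧ ∃ C, 0 ≤ C ∧ ∀ x, ‖rieszFun s φ x‖ ≤ C := by
  have h := integrable_laplaceSymbol_neg_mul hs hsn (𝓕 (toComplex φ))
  refine ⟨?_, ‖RCLike.map ℂ 𝕜‖ * ∫ ξ, ‖laplaceSymbol n (-s) ξ * (𝓕 (toComplex φ) : 𝓢(EuclideanSpace ℝ (Fin n), ℂ)) ξ‖,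
    mul_nonneg (norm_nonneg _) (integral_nonneg fun _ => norm_nonneg _), fun x => ?_⟩
  · refine (RCLike.map ℂ 𝕜).continuous.comp ?_
    rw [Real.fourierInv_eq_fourier_comp_neg]
    exact VectorFourier.fourierIntegral_continuous Real.continuous_fourierChar
      (L := innerₗ _) continuous_inner h.comp_neg
  · refine ((RCLike.map ℂ 𝕜).le_opNorm _).trans ?_
    gcongr
    rw [Real.fourierInv_eq_fourier_neg]
    exact norm_fourier_le_integral _ _

theorem rieszFun_add (hs : 0 < s) (hsn : s < n) (φ ψ : 𝓢(EuclideanSpace ℝ (Fin n), 𝕜))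
    (x : EuclideanSpace ℝ (Fin n)) : rieszFun s (φ + ψ) x = rieszFun s φ x + rieszFun s ψ x := by
  have h1 := integrable_laplaceSymbol_neg_mul hs hsn (𝓕 (toComplex φ))
  have h2 := integrable_laplaceSymbol_neg_mul hs hsn (𝓕 (toComplex ψ))
  have e : 𝓕 (toComplex (φ + ψ)) = 𝓕 (toComplex φ) + 𝓕 (toComplex ψ) := by
    rw [← FourierTransform.fourier_add]
    congr 1
    exact map_add (postcompCLM (𝕜 := ℝ) (RCLike.map 𝕜 ℂ)) φ ψ
  simp only [rieszFun, multiplier, ← map_add]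
  congr 1
  rw [e, Real.fourierInv_eq, Real.fourierInv_eq, Real.fourierInv_eq, ← integral_add]
  · simp [mul_add, smul_add]
  · simpa using (Real.fourierIntegral_convergent_iff (-x)).mpr h1
  · simpa using (Real.fourierIntegral_convergent_iff (-x)).mpr h2

theorem map_complex_mul (c : 𝕜) (z : ℂ) :
    RCLike.map ℂ 𝕜 (RCLike.map 𝕜 ℂ c * z) = c * RCLike.map ℂ 𝕜 z := by
  rcases RCLike.I_mul_I (K := 𝕜) with h | h
  · have hc : RCLike.im c = 0 := RCLike.im_eq_zero h c
    apply RCLike.ext <;> simp [h, hc]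
  · have hI : RCLike.im (RCLike.I : 𝕜) = 1 := by
      have h1 := congrArg RCLike.re h
      have h2 := RCLike.I_im (RCLike.I : 𝕜)
      simp only [RCLike.mul_re, RCLike.I_re, map_neg, RCLike.one_re] at h1
      linarith
    apply RCLike.ext <;> simp [hI]

theorem rieszFun_smul (c : 𝕜) (φ : 𝓢(EuclideanSpace ℝ (Fin n), 𝕜))
    (x : EuclideanSpace ℝ (Fin n)) : rieszFun s (c • φ) x = c * rieszFun s φ x := by
  have e : 𝓕 (toComplex (c • φ)) = (RCLike.map 𝕜 ℂ c) • 𝓕 (toComplex φ) := by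
    rw [← FourierTransform.fourier_smul]
    congr 1
    ext y
    simp [toComplex]
    apply Complex.ext <;> simp
  simp only [rieszFun, multiplier]
  rw [e, ← map_complex_mul]
  congr 1
  rw [Real.fourierInv_eq, Real.fourierInv_eq, ← smul_eq_mul, ← integral_smul]
  congr 1
  ext ξ
  simp [mul_left_comm, Circle.smul_def]

theorem integrable_rieszFun_mul (hs : 0 < s) (hsn : s < n) (φ : 𝓢(EuclideanSpace ℝ (Fin n), 𝕜))
    (f : TestSpace 𝕜 n s) : Integrable fun x => rieszFun s φ x * f x := by
  obtain ⟨h1, C, -, h2⟩ := rieszFun_continuous_bounded hs hsn φ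
  exact (f.integrable hs).bdd_mul h1.aestronglyMeasurable (Eventually.of_forall h2)

/-- The functional `f ↦ ∫ (I_s φ) f` on `𝒮_s`. -/
def rieszPairing (hs : 0 < s) (hsn : s < n) (φ : 𝓢(EuclideanSpace ℝ (Fin n), 𝕜)) :
    TestSpace 𝕜 n s →ₗ[𝕜] 𝕜 where
  toFun f := ∫ x, rieszFun s φ x * f x
  map_add' f g := by
    rw [← integral_add (integrable_rieszFun_mul hs hsn φ f) (integrable_rieszFun_mul hs hsn φ g)]
    congr 1
    ext x
    exact mul_add _ _ _
  map_smul' c f := by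
    rw [RingHom.id_apply, ← integral_smul]
    congr 1
    ext x
    exact mul_left_comm _ _ _

theorem rieszPairing_continuous (hs : 0 < s) (hsn : s < n)
    (φ : 𝓢(EuclideanSpace ℝ (Fin n), 𝕜)) : Continuous (rieszPairing hs hsn φ) := by
  obtain ⟨-, C, hC0, hC⟩ := rieszFun_continuous_bounded hs hsn φ
  let J := ∫ x : EuclideanSpace ℝ (Fin n), (1 + ‖x‖) ^ (-((n : ℝ) + s))
  have hJ : 0 ≤ J := integral_nonneg fun _ => by positivity
  have hint := integrable_one_add_norm
    (μ := (volume : Measure (EuclideanSpace ℝ (Fin n)))) (r := (n : ℝ) + s)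
    (by rw [finrank_euclideanSpace_fin]; linarith)
  let D : ℝ := C * (2 ^ ((n : ℝ) + s) * J)
  have hD : 0 ≤ D := by positivity
  refine (testSpace_withSeminorms 𝕜 n s).continuous_normedSpace_rng 𝕜 _
    ⟨{0}, ⟨D, hD⟩, fun f => ?_⟩
  rw [Finset.sup_singleton]
  change ‖∫ x, rieszFun s φ x * f x‖ ≤ D * testSeminorm 𝕜 n s 0 f
  calc _ ≤ ∫ x, C * (testSeminorm 𝕜 n s 0 f *
          (2 ^ ((n : ℝ) + s) * (1 + ‖x‖) ^ (-((n : ℝ) + s)))) := by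
        refine norm_integral_le_of_norm_le (((hint.const_mul _).const_mul _).const_mul _)
          (Eventually.of_forall fun x => ?_)
        rw [norm_mul]
        exact mul_le_mul (hC x) (f.norm_le hs x) (norm_nonneg _) hC0
    _ = _ := by
        rw [integral_const_mul, integral_const_mul, integral_const_mul]
        ring

/-- The Riesz potential `I_s : 𝒮 → 𝒮_s'`; the bounded function `I_s φ` acts on `𝒮_s` by
integration. -/
def rieszPotential (hs : 0 < s) (hsn : s < n) :
    𝓢(EuclideanSpace ℝ (Fin n), 𝕜) →ₗ[𝕜] TestDual 𝕜 n s where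
  toFun φ := ⟨rieszPairing hs hsn φ, rieszPairing_continuous hs hsn φ⟩
  map_add' φ ψ := by
    ext f
    change ∫ x, rieszFun s (φ + ψ) x * f x = (∫ x, rieszFun s φ x * f x) + ∫ x, rieszFun s ψ x * f x
    rw [← integral_add (integrable_rieszFun_mul hs hsn φ f) (integrable_rieszFun_mul hs hsn ψ f)]
    simp only [rieszFun_add hs hsn, add_mul]
  map_smul' c φ := by
    ext f
    change ∫ x, rieszFun s (c • φ) x * f x = c • ∫ x, rieszFun s φ x * f x
    rw [← integral_smul]
    simp only [rieszFun_smul, smul_eq_mul, mul_assoc]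

variable (𝕜 n)

/-- The space `I_s(𝒮)`, the image of the Schwartz class under the Riesz potential. -/
def rieszImage (hs : 0 < s) (hsn : s < n) : Submodule 𝕜 (TestDual 𝕜 n s) :=
  LinearMap.range (rieszPotential (𝕜 := 𝕜) hs hsn)

end defs

end

end FracHardySobolev

namespace FracHardySobolev

open MeasureTheory SchwartzMap Filter Topology FourierTransform
open scoped ContDiff ENNReal ComplexConjugate

section

variable {𝕜 : Type*} [RCLike 𝕜] {n : ℕ} {s : ℝ}

/-! On the Fourier side `I_s` divides by `(2π|ξ|)^s` and `∇ˢ₊` multiplies by it, so `∇ˢ₊ I_s φ = φ`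
(`gradPlus_rieszPotential`, from the Parseval formula `map_integral_rieszFun_mul_multiplier`). Hence
`∇ˢ₊` maps `I_s(𝒮)` onto `𝒮 ⊂ L¹`, and density of `I_s(𝒮)` in `H^{s,1}_+` is density of `𝒮` in `L¹`.

In contrast `∇ˢ₋ I_s φ` is, up to sign, the vector of Riesz transforms of `φ`. Its Fourier transform
is a multiple of `φ̂(ξ) ξ/|ξ|`, which jumps at the origin when `φ̂(0) ≠ 0`, whereas an integrable
function has a continuous Fourier transform. The jump is detected by duality. Let `φ̂ = b` be a
cutoff equal to `1` near `0`, and let `ψ_r` have Fourier transform `r^n G(rξ)` with `G(ξ) = i ξ_j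
b(ξ)`. Then `ψ_r(x) = Ǧ(x/r)` is bounded uniformly in `r` and tends to `Ǧ(0) = ∫ G = 0`, so its
integral against any `L¹` function tends to `0` (`tendsto_integral_schwartzFourierInv_dilate`).
Since `ξ_j/|ξ|` has degree `0`, the pairing of `∇ˢ_j I_s φ` with `ψ_r` is, up to sign, the same
positive number `∫ ξ_j² |ξ|⁻¹ b` for every `r ≥ 2` (`map_rieszPotential_gradMinusTest`), a
contradiction. -/

/-! ### Real and complex scalars: transfer to `ℂ` and conjugation symmetry. -/

theorem map_complex_mul_of_rclike (a b : 𝕜) :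
    RCLike.map 𝕜 ℂ (a * b) = RCLike.map 𝕜 ℂ a * RCLike.map 𝕜 ℂ b := by
  apply Complex.ext <;> simp

theorem norm_map_complex (a : 𝕜) : ‖RCLike.map 𝕜 ℂ a‖ = ‖a‖ := by
  rw [← sq_eq_sq₀ (norm_nonneg _) (norm_nonneg _), Complex.sq_norm, Complex.normSq_apply,
    RCLike.norm_sq_eq_def]
  simp

theorem map_complex_injective : Function.Injective (RCLike.map 𝕜 ℂ) := by
  intro a b h
  rw [← sub_eq_zero, ← norm_eq_zero, ← norm_map_complex, map_sub, h, sub_self, norm_zero]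

/-- The condition `RCLike.I = 0` singles out the real case, the only one in which passing through
`𝕜` discards the imaginary part. -/
theorem map_complex_map (z : ℂ) (hz : (RCLike.I : 𝕜) = 0 → conj z = z) :
    RCLike.map 𝕜 ℂ (RCLike.map ℂ 𝕜 z) = z := by
  rcases RCLike.I_mul_I (K := 𝕜) with h | h
  · have h1 : z.im = 0 := Complex.conj_eq_iff_im.mp (hz h)
    apply Complex.ext <;> simp [h, h1]
  · have hI : RCLike.im (RCLike.I : 𝕜) = 1 := by
      have h1 := congrArg RCLike.re h
      have h2 := RCLike.I_im (RCLike.I : 𝕜)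
      simp only [RCLike.mul_re, RCLike.I_re, map_neg, RCLike.one_re] at h1
      linarith
    apply Complex.ext <;> simp [hI]

/-- Conjugating the character amounts to `ξ ↦ -ξ`, which the Hermitian symmetry of `G` undoes. -/
theorem conj_fourierInv {V : Type*} [NormedAddCommGroup V] [InnerProductSpace ℝ V]
    [FiniteDimensional ℝ V] [MeasurableSpace V] [BorelSpace V] {G : V → ℂ}
    (hG : ∀ ξ, G (-ξ) = conj (G ξ)) (x : V) : conj (𝓕⁻ G x) = 𝓕⁻ G x := by
  rw [Real.fourierInv_eq, ← integral_conj, ← integral_neg_eq_self]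
  congr 1
  ext ξ
  rw [hG, Circle.smul_def, Circle.smul_def, smul_eq_mul, smul_eq_mul, map_mul, Complex.conj_conj,
    inner_neg_left, AddChar.map_neg_eq_inv, Circle.coe_inv_eq_conj, Complex.conj_conj]

theorem fourier_neg_eq_conj {V : Type*} [NormedAddCommGroup V] [InnerProductSpace ℝ V]
    [FiniteDimensional ℝ V] [MeasurableSpace V] [BorelSpace V] {f : V → ℂ}
    (hf : ∀ x, conj (f x) = f x) (ξ : V) : 𝓕 f (-ξ) = conj (𝓕 f ξ) := by
  rw [Real.fourier_eq, Real.fourier_eq, ← integral_conj]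
  congr 1
  ext x
  rw [Circle.smul_def, Circle.smul_def, smul_eq_mul, smul_eq_mul, map_mul, hf,
    inner_neg_right, AddChar.map_neg_eq_inv, Circle.coe_inv_eq_conj]

theorem toComplex_apply (φ : 𝓢(EuclideanSpace ℝ (Fin n), 𝕜)) (x : EuclideanSpace ℝ (Fin n)) :
    toComplex φ x = RCLike.map 𝕜 ℂ (φ x) := rfl

theorem conj_toComplex (h : (RCLike.I : 𝕜) = 0) (φ : 𝓢(EuclideanSpace ℝ (Fin n), 𝕜))
    (x : EuclideanSpace ℝ (Fin n)) : conj (toComplex φ x) = toComplex φ x := by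
  rw [toComplex_apply, Complex.conj_eq_iff_im]
  simp [RCLike.im_eq_zero h]

/-- A symbol with `m(-ξ)` conjugate to `m(ξ)` preserves real-valued functions. -/
theorem map_multiplier {m : EuclideanSpace ℝ (Fin n) → ℂ} (hm : ∀ ξ, m (-ξ) = conj (m ξ))
    (φ : 𝓢(EuclideanSpace ℝ (Fin n), 𝕜)) (x : EuclideanSpace ℝ (Fin n)) :
    RCLike.map 𝕜 ℂ (multiplier m φ x) =
      𝓕⁻ (fun ξ => m ξ * 𝓕 (toComplex φ : EuclideanSpace ℝ (Fin n) → ℂ) ξ) x := by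
  refine map_complex_map _ fun h => conj_fourierInv (fun ξ => ?_) x
  rw [map_mul, hm]
  congr 1
  exact fourier_neg_eq_conj (conj_toComplex h φ) ξ

theorem laplaceSymbol_neg (σ : ℝ) (ξ : EuclideanSpace ℝ (Fin n)) :
    laplaceSymbol n σ (-ξ) = conj (laplaceSymbol n σ ξ) := by
  simp only [laplaceSymbol, norm_neg, Complex.conj_ofReal]

theorem gradSymbol_neg (j : Fin n) (ξ : EuclideanSpace ℝ (Fin n)) :
    gradSymbol n s j (-ξ) = conj (gradSymbol n s j ξ) := by
  simp [gradSymbol, Complex.conj_ofReal, map_ofNat]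

/-! ### Parseval formulas. -/

theorem integral_fourier_mul_eq_of_integrable {V : Type*} [NormedAddCommGroup V]
    [InnerProductSpace ℝ V] [FiniteDimensional ℝ V] [MeasurableSpace V] [BorelSpace V]
    {f g : V → ℂ} (hf : Integrable f) (hg : Integrable g) :
    ∫ ξ, 𝓕 f ξ * g ξ = ∫ x, f x * 𝓕 g x := by
  simpa using! (VectorFourier.integral_fourierIntegral_smul_eq_flip (L := innerₗ V)
    Real.continuous_fourierChar continuous_inner hf hg)

/-- The pairing is bilinear, without conjugation, hence `g (-ξ)`. Fourier inversion is applied to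
`g` alone, so nothing is asked of `𝓕⁻ f`; this suits `f = (2π|ξ|)^(-s) φ̂`, singular at the origin,
for which only the boundedness of `I_s φ` has been established. -/
theorem integral_fourierInv_mul_fourierInv {V : Type*} [NormedAddCommGroup V]
    [InnerProductSpace ℝ V] [FiniteDimensional ℝ V] [MeasurableSpace V] [BorelSpace V]
    {f g : V → ℂ} (hf : Integrable f) (hg : Integrable g) (hc : Continuous g)
    (hg' : Integrable (𝓕⁻ g)) : ∫ x, 𝓕⁻ f x * 𝓕⁻ g x = ∫ ξ, f ξ * g (-ξ) := by
  have e : (fun x => g (-x)) = 𝓕 (fun x => 𝓕⁻ g (-x)) := by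
    have h1 : Integrable (𝓕 fun x => g (-x)) := by
      rwa [← Real.fourierInv_eq_fourier_comp_neg]
    have h2 := (hc.comp continuous_neg).fourierInv_fourier_eq hg.comp_neg h1
    have h3 : 𝓕 (fun x => g (-x)) = 𝓕⁻ g := (Real.fourierInv_eq_fourier_comp_neg g).symm
    simp only [Function.comp_def] at h2
    rw [h3, Real.fourierInv_eq_fourier_comp_neg] at h2
    exact h2.symm
  have h := integral_fourier_mul_eq_of_integrable hf hg'.comp_neg
  rw [← e] at h
  rw [← h, ← integral_neg_eq_self]
  simp only [Real.fourierInv_eq_fourier_neg f, neg_neg]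

/-- Parseval's formula for a Riesz potential and a multiplier of positive order. -/
theorem map_integral_rieszFun_mul_multiplier (hs : 0 < s) (hsn : s < n)
    {m : EuclideanSpace ℝ (Fin n) → ℂ} (hm : ∀ ξ, ξ ≠ 0 → ContDiffAt ℝ ∞ m ξ)
    (hh : ∀ t : ℝ, 0 < t → ∀ ξ, m (t • ξ) = (t ^ s) • m ξ) (hmn : ∀ ξ, m (-ξ) = conj (m ξ))
    (φ ψ : 𝓢(EuclideanSpace ℝ (Fin n), 𝕜)) :
    RCLike.map 𝕜 ℂ (∫ x, rieszFun s φ x * multiplier m ψ x) =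
      ∫ ξ, laplaceSymbol n (-s) ξ * 𝓕 (toComplex φ : EuclideanSpace ℝ (Fin n) → ℂ) ξ *
        (m (-ξ) * 𝓕 (toComplex ψ : EuclideanSpace ℝ (Fin n) → ℂ) (-ξ)) := by
  -- Membership in `𝒮_s` carries the decay `|x|^(-n-s)`, which makes `multiplier m ψ` integrable.
  let f : TestSpace 𝕜 n s := ⟨multiplier m ψ, multiplier_mem hs hm hh ψ⟩
  have hint : Integrable fun x => rieszFun s φ x * multiplier m ψ x :=
    integrable_rieszFun_mul hs hsn φ f
  have hf : Integrable (multiplier m ψ) := f.integrable hs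
  rw [← ContinuousLinearMap.integral_comp_comm _ hint]
  simp only [map_complex_mul_of_rclike, rieszFun, map_multiplier hmn,
    map_multiplier (laplaceSymbol_neg (-s))]
  have hint' : Integrable
      fun ξ => m ξ * 𝓕 (toComplex ψ : EuclideanSpace ℝ (Fin n) → ℂ) ξ :=
    integrable_symbol_smul hs hm hh (𝓕 (toComplex ψ))
  refine integral_fourierInv_mul_fourierInv
    (integrable_laplaceSymbol_neg_mul hs hsn (𝓕 (toComplex φ))) hint' ?_ ?_
  · exact (exists_norm_symbol_le hs hm hh).1.mul (𝓕 (toComplex ψ)).continuous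
  -- The inverse transform of `m ψ̂` is `multiplier m ψ` read in `ℂ`, so its integrability is `hf`.
  · have h := (RCLike.map 𝕜 ℂ).integrable_comp hf
    simp only [map_multiplier hmn] at h
    exact h

theorem laplaceSymbol_neg_mul_laplaceSymbol {ξ : EuclideanSpace ℝ (Fin n)} (hξ : ξ ≠ 0) :
    laplaceSymbol n (-s) ξ * laplaceSymbol n s ξ = 1 := by
  have h : 0 < 2 * Real.pi * ‖ξ‖ := by
    have := norm_pos_iff.mpr hξ
    have := Real.pi_pos
    positivity
  rw [laplaceSymbol, laplaceSymbol, ← Complex.ofReal_mul, ← Real.rpow_add h]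
  simp

theorem ae_ne_zero (hn : 0 < n) : ∀ᵐ ξ : EuclideanSpace ℝ (Fin n), ξ ≠ 0 := by
  have : Nonempty (Fin n) := ⟨⟨0, hn⟩⟩
  exact Measure.ae_ne volume 0

theorem fourier_toComplex_mul_integral (φ ψ : 𝓢(EuclideanSpace ℝ (Fin n), 𝕜)) :
    ∫ ξ, 𝓕 (toComplex φ : EuclideanSpace ℝ (Fin n) → ℂ) ξ *
      𝓕 (toComplex ψ : EuclideanSpace ℝ (Fin n) → ℂ) (-ξ) =
      ∫ x, toComplex φ x * toComplex ψ x := by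
  have e : (toComplex ψ : EuclideanSpace ℝ (Fin n) → ℂ) =
      𝓕 (fun ξ => 𝓕 (toComplex ψ : EuclideanSpace ℝ (Fin n) → ℂ) (-ξ)) := by
    rw [← Real.fourierInv_eq_fourier_comp_neg]
    exact ((toComplex ψ).continuous.fourierInv_fourier_eq (toComplex ψ).integrable
      (𝓕 (toComplex ψ)).integrable).symm
  rw [integral_fourier_mul_eq_of_integrable (toComplex φ).integrable
    (𝓕 (toComplex ψ)).integrable.comp_neg]
  conv_rhs => rw [e]

/-! ### Riesz potentials in `H^{s,1}_+` and their density. -/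

/-- `∇ˢ₊ I_s φ = φ`. -/
theorem gradPlus_rieszPotential (hs : 0 < s) (hsn : s < n)
    (φ ψ : 𝓢(EuclideanSpace ℝ (Fin n), 𝕜)) :
    gradPlus hs (rieszPotential hs hsn φ) ψ = ∫ x, ψ x • φ x := by
  have hn : 0 < n := by
    have : (0 : ℝ) < n := hs.trans hsn
    exact_mod_cast this
  apply map_complex_injective
  rw [← ContinuousLinearMap.integral_comp_comm _ (integrable_schwartz_smul ψ φ.integrable)]
  refine (map_integral_rieszFun_mul_multiplier hs hsn (laplaceSymbol_contDiffAt s)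
    (fun t ht => laplaceSymbol_smul s t ht) (laplaceSymbol_neg s) φ ψ).trans ?_
  simp only [smul_eq_mul, map_complex_mul_of_rclike]
  trans ∫ x, toComplex φ x * toComplex ψ x
  · rw [← fourier_toComplex_mul_integral]
    -- The two symbols cancel off the origin, a null set because `n > 0`.
    refine integral_congr_ae ((ae_ne_zero hn).mono fun ξ hξ => ?_)
    have h1 := laplaceSymbol_neg_mul_laplaceSymbol (s := s) hξ
    have h2 : laplaceSymbol n s (-ξ) = laplaceSymbol n s ξ := by simp [laplaceSymbol]
    dsimp only
    rw [h2, mul_mul_mul_comm, h1, one_mul]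
  · simp only [toComplex_apply, mul_comm]

theorem rieszPotential_mem_HPlus (hs : 0 < s) (hsn : s < n)
    (φ : 𝓢(EuclideanSpace ℝ (Fin n), 𝕜)) : rieszPotential hs hsn φ ∈ HPlus 𝕜 n hs :=
  distL1Norm_lt_top.mpr ⟨φ, φ.integrable, gradPlus_rieszPotential hs hsn φ⟩

theorem exists_normPlus_sub_rieszPotential_lt (hs : 0 < s) (hsn : s < n) {u : TestDual 𝕜 n s}
    (hu : u ∈ HPlus 𝕜 n hs) {ε : ℝ≥0∞} (hε : 0 < ε) :
    ∃ φ, normPlus hs (u - rieszPotential hs hsn φ) < ε := by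
  obtain ⟨h, hh, hu⟩ := distL1Norm_lt_top.mp hu
  -- A finite `δ < ε` turns the non-strict `L¹` approximation into a strict bound and covers `ε =
  -- ∞`.
  obtain ⟨δ, hδ, hδε⟩ := ENNReal.lt_iff_exists_nnreal_btwn.mp hε
  have hδ0 : (0 : ℝ) < δ := by exact_mod_cast hδ
  obtain ⟨g, hg1, hg2, hg3⟩ := MemLp.exist_eLpNorm_sub_le ENNReal.one_ne_top le_rfl
    (memLp_one_iff_integrable.mpr hh) hδ0
  let φ : 𝓢(EuclideanSpace ℝ (Fin n), 𝕜) := hg1.toSchwartzMap hg2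
  refine ⟨φ, lt_of_le_of_lt ?_ hδε⟩
  -- The norm is an infimum over representing functions, so the single representative `h - φ` bounds
  -- it.
  refine (iInf_le_of_le (fun x => h x - φ x) (iInf_le_of_le (hh.sub φ.integrable)
    (iInf_le_of_le (fun ψ => ?_) ?_)))
  · have e : gradPlus hs (u - rieszPotential hs hsn φ) ψ =
      gradPlus hs u ψ - gradPlus hs (rieszPotential hs hsn φ) ψ := rfl
    rw [e, hu, gradPlus_rieszPotential, ← integral_sub (integrable_schwartz_smul ψ hh)
      (integrable_schwartz_smul ψ φ.integrable)]
    simp only [smul_sub]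
  · rw [eLpNorm_one_eq_lintegral_enorm, ENNReal.ofReal_coe_nnreal] at hg3
    exact hg3

/-! ### Test functions prescribed by their Fourier transforms, and their dilates. -/

variable (𝕜) in
/-- The inverse Fourier transform of a Schwartz function, as a `𝕜`-valued function. -/
noncomputable def schwartzFourierInv (G : 𝓢(EuclideanSpace ℝ (Fin n), ℂ)) :
    𝓢(EuclideanSpace ℝ (Fin n), 𝕜) :=
  postcompCLM (𝕜 := ℝ) (RCLike.map ℂ 𝕜) (𝓕⁻ G)

theorem schwartzFourierInv_apply (G : 𝓢(EuclideanSpace ℝ (Fin n), ℂ))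
    (x : EuclideanSpace ℝ (Fin n)) :
    schwartzFourierInv 𝕜 G x = RCLike.map ℂ 𝕜 (𝓕⁻ (G : EuclideanSpace ℝ (Fin n) → ℂ) x) := by
  rw [← SchwartzMap.fourierInv_coe]
  rfl

/-- The symmetry of `G` makes its inverse transform real, so the projection to `𝕜` loses nothing
even when `𝕜 = ℝ`. -/
theorem fourier_toComplex_schwartzFourierInv {G : 𝓢(EuclideanSpace ℝ (Fin n), ℂ)}
    (hG : ∀ ξ, G (-ξ) = conj (G ξ)) :
    𝓕 (toComplex (schwartzFourierInv 𝕜 G) : EuclideanSpace ℝ (Fin n) → ℂ) = G := by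
  have e : toComplex (schwartzFourierInv 𝕜 G) = 𝓕⁻ G := by
    ext x
    rw [toComplex_apply, schwartzFourierInv_apply, SchwartzMap.fourierInv_coe]
    exact map_complex_map _ fun _ => conj_fourierInv hG x
  rw [e, ← SchwartzMap.fourier_coe, FourierTransform.fourier_fourierInv_eq]

/-- The dilate `r ^ n G(r ξ)`. -/
noncomputable def dilate (r : ℝ) (hr : 0 < r) (G : 𝓢(EuclideanSpace ℝ (Fin n), ℂ)) :
    𝓢(EuclideanSpace ℝ (Fin n), ℂ) :=
  (r ^ n : ℝ) • compCLMOfContinuousLinearEquiv ℝ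
    (ContinuousLinearEquiv.smulLeft (Units.mk0 r hr.ne')) G

theorem dilate_apply (r : ℝ) (hr : 0 < r) (G : 𝓢(EuclideanSpace ℝ (Fin n), ℂ))
    (ξ : EuclideanSpace ℝ (Fin n)) : dilate r hr G ξ = (r ^ n : ℝ) • G (r • ξ) := rfl

theorem integral_pow_smul_comp_smul {F : Type*} [NormedAddCommGroup F] [NormedSpace ℝ F]
    (f : EuclideanSpace ℝ (Fin n) → F) {r : ℝ} (hr : 0 < r) :
    ∫ ξ, (r ^ n : ℝ) • f (r • ξ) = ∫ ξ, f ξ := by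
  rw [integral_smul, Measure.integral_comp_smul, finrank_euclideanSpace_fin, smul_smul,
    abs_of_pos (by positivity), mul_inv_cancel₀ (by positivity), one_smul]

/-- The factor `r ^ n` is the Jacobian: the inverse transform spreads out as `r` grows while its
supremum stays fixed. -/
theorem fourierInv_dilate {r : ℝ} (hr : 0 < r) (G : 𝓢(EuclideanSpace ℝ (Fin n), ℂ))
    (x : EuclideanSpace ℝ (Fin n)) :
    𝓕⁻ (dilate r hr G : EuclideanSpace ℝ (Fin n) → ℂ) x =
      𝓕⁻ (G : EuclideanSpace ℝ (Fin n) → ℂ) (r⁻¹ • x) := by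
  rw [Real.fourierInv_eq, Real.fourierInv_eq, ← integral_pow_smul_comp_smul
    (fun ξ => Real.fourierChar (inner ℝ ξ (r⁻¹ • x)) • G ξ) hr]
  congr 1
  ext ξ
  rw [dilate_apply, smul_comm, inner_smul_left, inner_smul_right, conj_trivial, ← mul_assoc,
    mul_inv_cancel₀ hr.ne', one_mul]

/-- Dilating an odd symbol towards infinity makes its inverse Fourier transform tend weakly to
zero against integrable functions. -/
theorem tendsto_integral_schwartzFourierInv_dilate {F : Type*} [NormedAddCommGroup F]
    [NormedSpace ℝ F] [NormedSpace 𝕜 F] {G : 𝓢(EuclideanSpace ℝ (Fin n), ℂ)}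
    (hG : ∀ ξ, G (-ξ) = -G ξ) {h : EuclideanSpace ℝ (Fin n) → F} (hh : Integrable h)
    {r : ℕ → ℝ} (hr : ∀ k, 0 < r k) (hr' : Tendsto r atTop atTop) :
    Tendsto (fun k => ∫ x, schwartzFourierInv 𝕜 (dilate (r k) (hr k) G) x • h x) atTop (𝓝 0) := by
  -- The value at the origin is `∫ G`, zero by oddness.
  have hz : 𝓕⁻ (G : EuclideanSpace ℝ (Fin n) → ℂ) 0 = 0 := by
    have h1 : ∫ ξ, G ξ = -∫ ξ, G ξ := by
      conv_lhs => rw [← integral_neg_eq_self]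
      simp only [hG, integral_neg]
    rw [Real.fourierInv_eq]
    simpa [self_eq_neg] using h1
  have hcont : Continuous (𝓕⁻ (G : EuclideanSpace ℝ (Fin n) → ℂ)) := by
    rw [← SchwartzMap.fourierInv_coe]
    exact (𝓕⁻ G).continuous
  -- A bound independent of `k`, giving the integrable majorant for dominated convergence.
  have hb : ∀ k x, ‖schwartzFourierInv 𝕜 (dilate (r k) (hr k) G) x‖ ≤
      ‖RCLike.map ℂ 𝕜‖ * ∫ ξ, ‖G ξ‖ := by
    intro k x
    rw [schwartzFourierInv_apply, fourierInv_dilate, Real.fourierInv_eq_fourier_neg]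
    refine ((RCLike.map ℂ 𝕜).le_opNorm _).trans ?_
    gcongr
    exact norm_fourier_le_integral _ _
  rw [← integral_zero (EuclideanSpace ℝ (Fin n)) F (μ := volume)]
  refine tendsto_integral_of_dominated_convergence
    (fun x => (‖RCLike.map ℂ 𝕜‖ * ∫ ξ, ‖G ξ‖) * ‖h x‖)
    (fun k => (integrable_schwartz_smul _ hh).aestronglyMeasurable) (hh.norm.const_mul _)
    (fun k => Eventually.of_forall fun x => ?_) (Eventually.of_forall fun x => ?_)
  · rw [norm_smul]
    gcongr
    exact hb k x
  · rw [← zero_smul 𝕜 (h x)]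
    refine Tendsto.smul_const ?_ _
    simp only [schwartzFourierInv_apply, fourierInv_dilate]
    have h1 : Tendsto (fun k => (r k)⁻¹ • x) atTop (𝓝 0) := by
      rw [← zero_smul ℝ x]
      exact (tendsto_inv_atTop_zero.comp hr').smul_const x
    have h2 := ((RCLike.map ℂ 𝕜).continuous.comp hcont).tendsto 0
    simp only [Function.comp_def, hz, map_zero] at h2
    exact h2.comp h1

/-! ### The cutoff whose Riesz potential lies outside `H^{s,1}_-`. -/

/-- A smooth radial cutoff, equal to `1` on the unit ball. -/
noncomputable def bump (n : ℕ) : ContDiffBump (0 : EuclideanSpace ℝ (Fin n)) :=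
  ⟨1, 2, one_pos, one_lt_two⟩

theorem bump_neg (ξ : EuclideanSpace ℝ (Fin n)) : bump n (-ξ) = bump n ξ := (bump n).neg ξ

/-- The cutoff as a complex Schwartz function. -/
noncomputable def bumpSchwartz (n : ℕ) : 𝓢(EuclideanSpace ℝ (Fin n), ℂ) :=
  HasCompactSupport.toSchwartzMap (f := fun ξ => (bump n ξ : ℂ))
    ((bump n).hasCompactSupport.comp_left Complex.ofReal_zero)
    (Complex.ofRealCLM.contDiff.comp (bump n).contDiff)

/-- The odd Schwartz function `i ξ_j b(ξ)` with `b` the cutoff. -/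
noncomputable def coordBumpSchwartz (j : Fin n) : 𝓢(EuclideanSpace ℝ (Fin n), ℂ) :=
  HasCompactSupport.toSchwartzMap (f := fun ξ => Complex.I * (ξ j : ℂ) * (bump n ξ : ℂ))
    ((bump n).hasCompactSupport.comp_left Complex.ofReal_zero).mul_left
    ((contDiff_const.mul (Complex.ofRealCLM.comp (EuclideanSpace.proj (𝕜 := ℝ) j)).contDiff).mul
      (Complex.ofRealCLM.contDiff.comp (bump n).contDiff))

theorem bumpSchwartz_apply (ξ : EuclideanSpace ℝ (Fin n)) : bumpSchwartz n ξ = bump n ξ := rfl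

theorem coordBumpSchwartz_apply (j : Fin n) (ξ : EuclideanSpace ℝ (Fin n)) :
    coordBumpSchwartz j ξ = Complex.I * (ξ j : ℂ) * (bump n ξ : ℂ) := rfl

/-- The powers of order `s` cancel and leave a Riesz transform symbol, homogeneous of degree `0`.
The factor `ξ j` makes both sides vanish at the origin. -/
theorem laplaceSymbol_neg_mul_gradSymbol (j : Fin n) (ξ : EuclideanSpace ℝ (Fin n)) :
    laplaceSymbol n (-s) ξ * gradSymbol n s j ξ = -Complex.I * (ξ j : ℂ) * (‖ξ‖⁻¹ : ℝ) := by
  by_cases hξ : ξ = 0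
  · simp [hξ, gradSymbol]
  have hξ' := norm_pos_iff.mpr hξ
  have hpi := Real.pi_pos
  have h : 0 < 2 * Real.pi * ‖ξ‖ := by positivity
  have e : (2 * Real.pi * ‖ξ‖) ^ (-s) * (2 * Real.pi * ‖ξ‖) ^ (s - 1) =
      (2 * Real.pi)⁻¹ * ‖ξ‖⁻¹ := by
    rw [← Real.rpow_add h, show -s + (s - 1) = -1 by ring, Real.rpow_neg_one, mul_inv]
  have e' := congrArg (fun x : ℝ => (x : ℂ)) e
  simp only [Complex.ofReal_mul] at e'
  have hpi' : (Real.pi : ℂ) ≠ 0 := by exact_mod_cast hpi.ne'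
  rw [laplaceSymbol, gradSymbol]
  calc _ = -2 * Real.pi * Complex.I * (ξ j : ℂ) *
        ((((2 * Real.pi * ‖ξ‖) ^ (-s) : ℝ) : ℂ) * (((2 * Real.pi * ‖ξ‖) ^ (s - 1) : ℝ) : ℂ)) := by
        ring
    _ = _ := by
        rw [e']
        push_cast
        field_simp

theorem integral_coord_sq_mul_bump_pos (j : Fin n) :
    0 < ∫ ξ : EuclideanSpace ℝ (Fin n), (ξ j) ^ 2 * ‖ξ‖⁻¹ * bump n ξ := by
  have hmeas : Measurable fun ξ : EuclideanSpace ℝ (Fin n) => (ξ j) ^ 2 * ‖ξ‖⁻¹ * bump n ξ := by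
    have := (bump n).continuous.measurable
    have h2 : Measurable fun ξ : EuclideanSpace ℝ (Fin n) => ξ j :=
      (EuclideanSpace.proj (𝕜 := ℝ) j).continuous.measurable
    fun_prop
  have hnn : ∀ ξ : EuclideanSpace ℝ (Fin n), 0 ≤ (ξ j) ^ 2 * ‖ξ‖⁻¹ * bump n ξ := fun ξ => by
    have := (bump n).nonneg (x := ξ)
    positivity
  have hint : Integrable fun ξ : EuclideanSpace ℝ (Fin n) => ‖ξ‖ * bump n ξ :=
    (continuous_norm.mul (bump n).continuous).integrable_of_hasCompactSupport
      (bump n).hasCompactSupport.mul_left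
  rw [integral_pos_iff_support_of_nonneg hnn]
  · have hopen : IsOpen ({ξ : EuclideanSpace ℝ (Fin n) | ξ j ≠ 0} ∩ Metric.ball 0 1) :=
      (isOpen_ne_fun (EuclideanSpace.proj (𝕜 := ℝ) j).continuous continuous_const).inter
        Metric.isOpen_ball
    refine (hopen.measure_pos volume ⟨EuclideanSpace.single j (1 / 2), ?_, ?_⟩).trans_le
      (measure_mono ?_)
    · simp
    · simp
      norm_num
    · rintro ξ ⟨h1, h2⟩
      have h3 : bump n ξ = 1 := (bump n).one_of_mem_closedBall (Metric.ball_subset_closedBall h2)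
      have h4 : ξ ≠ 0 := by
        rintro rfl
        simp at h1
      simpa [h3, h4] using h1
  -- The singularity of `‖ξ‖⁻¹` is harmless: `(ξ j)² ≤ ‖ξ‖²` bounds the integrand by `‖ξ‖ * bump n
  -- ξ`.
  · refine hint.mono' hmeas.aestronglyMeasurable (Eventually.of_forall fun ξ => ?_)
    rw [Real.norm_of_nonneg (hnn ξ)]
    refine mul_le_mul_of_nonneg_right ?_ (bump n).nonneg
    have h1 : (ξ j) ^ 2 ≤ ‖ξ‖ ^ 2 := by
      rw [sq_le_sq, abs_norm]
      exact PiLp.norm_apply_le ξ j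
    calc _ ≤ ‖ξ‖ ^ 2 * ‖ξ‖⁻¹ := by gcongr
      _ ≤ ‖ξ‖ := by
        rcases (norm_nonneg ξ).eq_or_lt with h | h
        · simp [← h]
        · rw [pow_two, mul_assoc, mul_inv_cancel₀ h.ne', mul_one]

/-- The pairing of the Riesz transform of the cutoff with the dilated odd test functions does not
depend on the dilation. -/
theorem map_rieszPotential_gradMinusTest (hs : 0 < s) (hsn : s < n) (j : Fin n) {r : ℝ}
    (hr : 2 ≤ r) :
    RCLike.map 𝕜 ℂ (rieszPotential hs hsn (schwartzFourierInv 𝕜 (bumpSchwartz n))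
      (gradMinusTest hs j
        (schwartzFourierInv 𝕜 (dilate r (two_pos.trans_le hr) (coordBumpSchwartz j))))) =
      ((∫ ξ : EuclideanSpace ℝ (Fin n), (ξ j) ^ 2 * ‖ξ‖⁻¹ * bump n ξ : ℝ) : ℂ) := by
  have hr0 : 0 < r := two_pos.trans_le hr
  have h1 : ∀ ξ, bumpSchwartz n (-ξ) = conj (bumpSchwartz n ξ) := fun ξ => by
    rw [bumpSchwartz_apply, bumpSchwartz_apply, bump_neg, Complex.conj_ofReal]
  -- The factor `i` makes this odd symbol Hermitian, so that its inverse transform is real.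
  have h2 : ∀ ξ, dilate r hr0 (coordBumpSchwartz j) (-ξ) =
      conj (dilate r hr0 (coordBumpSchwartz j) ξ) := fun ξ => by
    rw [dilate_apply, dilate_apply, coordBumpSchwartz_apply, coordBumpSchwartz_apply, smul_neg,
      bump_neg]
    simp [Complex.conj_ofReal]
  refine (map_integral_rieszFun_mul_multiplier hs hsn (gradSymbol_contDiffAt j)
    (fun t ht => gradSymbol_smul j t ht) (gradSymbol_neg j) _ _).trans ?_
  -- Substituting `r • ξ` in the target integral reduces the claim to a pointwise identity of
  -- integrands.
  rw [fourier_toComplex_schwartzFourierInv h1, fourier_toComplex_schwartzFourierInv h2,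
    ← integral_complex_ofReal, ← integral_pow_smul_comp_smul
      (fun ξ : EuclideanSpace ℝ (Fin n) => (((ξ j) ^ 2 * ‖ξ‖⁻¹ * bump n ξ : ℝ) : ℂ)) hr0]
  congr 1
  ext ξ
  have hneg : laplaceSymbol n (-s) ξ = laplaceSymbol n (-s) (-ξ) := by simp [laplaceSymbol]
  -- Here `r ≥ 2` enters: the second cutoff vanishes when `‖r • ξ‖ ≥ 2`, hence when `‖ξ‖ > 1`, and
  -- the first equals `1` on the unit ball.
  have hb : bump n ξ * bump n (r • ξ) = bump n (r • ξ) := by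
    by_cases h : ‖ξ‖ ≤ 1
    · rw [(bump n).one_of_mem_closedBall (by simpa [bump] using h), one_mul]
    · rw [(bump n).zero_of_le_dist (x := r • ξ), mul_zero]
      rw [dist_zero_right, norm_smul, Real.norm_of_nonneg hr0.le]
      change 2 ≤ _
      push Not at h
      nlinarith
  have hb' := congrArg (fun x : ℝ => (x : ℂ)) hb
  simp only [Complex.ofReal_mul] at hb'
  rw [mul_mul_mul_comm, hneg, laplaceSymbol_neg_mul_gradSymbol, bumpSchwartz_apply, dilate_apply,
    coordBumpSchwartz_apply, smul_neg, bump_neg, norm_smul, Real.norm_of_nonneg hr0.le, norm_neg]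
  simp only [PiLp.neg_apply, PiLp.smul_apply, smul_eq_mul, Complex.real_smul, Complex.ofReal_mul,
    Complex.ofReal_neg, Complex.ofReal_pow, Complex.ofReal_inv]
  have hr' : (r : ℂ) ≠ 0 := by exact_mod_cast hr0.ne'
  conv_rhs => rw [← hb']
  field_simp
  rw [Complex.I_sq]
  ring

theorem rieszPotential_bump_notMem_HMinus (hs : 0 < s) (hsn : s < n) :
    rieszPotential hs hsn (schwartzFourierInv 𝕜 (bumpSchwartz n)) ∉ HMinus 𝕜 n hs := by
  have hn : 0 < n := by
    have : (0 : ℝ) < n := hs.trans hsn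
    exact_mod_cast this
  -- One bad component suffices; any coordinate would serve.
  let j : Fin n := ⟨0, hn⟩
  intro hmem
  obtain ⟨h, hh, hT⟩ := distL1Norm_lt_top.mp hmem
  -- The dilation factors `k + 2` tend to infinity and stay at least `2`, as the constancy of the
  -- pairing requires.
  have hr : ∀ k : ℕ, (2 : ℝ) ≤ k + 2 := fun k => by
    have : (0 : ℝ) ≤ k := k.cast_nonneg
    linarith
  have hodd : ∀ ξ, coordBumpSchwartz j (-ξ) = -coordBumpSchwartz j ξ := fun ξ => by
    rw [coordBumpSchwartz_apply, coordBumpSchwartz_apply, bump_neg]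
    simp
  have ht := tendsto_integral_schwartzFourierInv_dilate (𝕜 := 𝕜) hodd hh
    (fun k => two_pos.trans_le (hr k))
    (tendsto_atTop_add_const_right _ 2 tendsto_natCast_atTop_atTop)
  simp only [← hT] at ht
  have ht2 := (((RCLike.map 𝕜 ℂ).continuous.comp
    (EuclideanSpace.proj (𝕜 := 𝕜) j).continuous).tendsto 0).comp ht
  -- The minus sign is the one in the definition of `∇ˢ_j u` by duality.
  have e : ∀ k : ℕ, RCLike.map 𝕜 ℂ (EuclideanSpace.proj (𝕜 := 𝕜) j
      (gradMinus hs (rieszPotential hs hsn (schwartzFourierInv 𝕜 (bumpSchwartz n)))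
        (schwartzFourierInv 𝕜
          (dilate (k + 2 : ℝ) (two_pos.trans_le (hr k)) (coordBumpSchwartz j))))) =
      -((∫ ξ : EuclideanSpace ℝ (Fin n), (ξ j) ^ 2 * ‖ξ‖⁻¹ * bump n ξ : ℝ) : ℂ) := fun k => by
    rw [← map_rieszPotential_gradMinusTest (𝕜 := 𝕜) hs hsn j (hr k), ← map_neg]
    rfl
  simp only [Function.comp_def, e, map_zero] at ht2
  have h0 := tendsto_nhds_unique ht2 tendsto_const_nhds
  rw [zero_eq_neg, Complex.ofReal_eq_zero] at h0
  exact (integral_coord_sq_mul_bump_pos j).ne' h0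

end
end FracHardySobolev

/-- From `s < 1 ≤ n` comes `s < n`, the condition for `|ξ|^(-s)` to be locally integrable and so for
`I_s` to be defined on all of `𝒮`. -/
theorem mainTheorem11 {𝕜 : Type*} [RCLike 𝕜] (n : ℕ) (hn : 1 ≤ n) (s : ℝ)
    (hs : s ∈ Set.Ioo (0 : ℝ) 1) :
    FracHardySobolev.rieszImage 𝕜 n hs.1 (hs.2.trans_le (Nat.one_le_cast.mpr hn)) ≤
      FracHardySobolev.HPlus 𝕜 n hs.1 ∧
    (∀ u ∈ FracHardySobolev.HPlus 𝕜 n hs.1, ∀ ε : ENNReal, 0 < ε →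
      ∃ v ∈ FracHardySobolev.rieszImage 𝕜 n hs.1 (hs.2.trans_le (Nat.one_le_cast.mpr hn)),
        FracHardySobolev.normPlus hs.1 (u - v) < ε) ∧
    ¬ FracHardySobolev.rieszImage 𝕜 n hs.1 (hs.2.trans_le (Nat.one_le_cast.mpr hn)) ≤
      FracHardySobolev.HMinus 𝕜 n hs.1 := by
  refine ⟨?_, fun u hu ε hε => ?_, fun h => ?_⟩
  · rintro _ ⟨φ, rfl⟩
    exact FracHardySobolev.rieszPotential_mem_HPlus _ _ φ
  · obtain ⟨φ, hφ⟩ := FracHardySobolev.exists_normPlus_sub_rieszPotential_lt hs.1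
      (hs.2.trans_le (Nat.one_le_cast.mpr hn)) hu hε
    exact ⟨_, ⟨φ, rfl⟩, hφ⟩
  · exact FracHardySobolev.rieszPotential_bump_notMem_HMinus _ _ (h ⟨_, rfl⟩)
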